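/- **Setting.** Let $A\in\mathbb R^{2\times 2}$, $b,c\in\mathbb R^2$, $B=bc^T$, and let $\delta_{\min},\delta_{\max}:[0,1]\to\mathbb R$ be continuous with $\delta_{\min}\le 0\le\delta_{\max}$. Consider the closed loop $$\dot x = Ax+bu,\qquad y=c^Tx,\qquad u=\kappa(t)\,y,\qquad t\ge 0.$$ A gain $\kappa\in C^1([0,\infty))$ is *admissible* if $\kappa(t)\in[0,1]$ and $\delta_{\min}(\kappa(t))\le\dot\kappa(t)\le\delta_{\max}(\kappa(t))$ for all $t\ge0$. The system is *absolutely stable* if its zero solution is globally asymptotically stable under every admissible gain. Let $\mathbf i(\theta)=(\cos\theta,\sin\theta)^T$, $\mathbf j(\theta)=(-\sin\theta,\cos\theta)^T$, $$h(\kappa,\theta)=\mathbf i(\theta)^T(A+\kappa B)\mathbf i(\theta),\qquad g(\kappa,\theta)=\mathbf j(\theta)^T(A+\kappa B)\mathbf i(\theta),$$ so that $\dot r=hr$, $\dot\theta=g$ in polar coordinates. Assume $g(\kappa,\theta)>0$ for all $\kappa\in[0,1]$, $\theta\in\mathbb R$, and put $f=h/g$. Let $\nu_{\min}(\kappa)=\delta_{\min}(\kappa)$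 for $\kappa\in[0,1)$, $\nu_{\min}(1)=0$, and $\nu_{\max}(\kappa)=\delta_{\max}(\kappa)$ for $\kappa\in(0,1]$, $\nu_{\max}(0)=0$. Let $\rho(\kappa,\theta)$, continuous on $[0,1]\times[0,\infty)$, be a viscosity solution on $[0,1]\times(0,\infty)$ (test functions touching $\rho$ relative to this set, boundary points $\kappa=0,1$ included) of the Hamilton–Jacobi–Bellman equation $$\rho_\theta+\frac1{g(\kappa,\theta)}\min_{\nu_{\min}(\kappa)\le\nu\le\nu_{\max}(\kappa)}\{\nu\,\rho_\kappa\}=f(\kappa,\theta)\,\rho,\qquad \rho(\kappa,0)=1\ \text{ for all }\kappa\in[0,1],$$ where subsolution means "$\le$" for $C^1$ functions touching $\rho$ from above, and supersolution means "$\ge$" for $C^1$ functions touching $\rho$ from below. **Theorem (Instability).** If for some $N\in\mathbb N$ one has $\rho(\kappa,N\pi)>1$ for all $\kappa\in[0,1]$, then the system is not absolutely stable. -/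

import Mathlib

open Set Filter Topology Matrix

noncomputable section

/-- The data of the uncertain closed loop `x' = A x + b u`, `y = cᵀ x`, `u = κ(t) y`:
the planar SISO system `(A, b, c)` and the bounds `δmin`, `δmax` on the derivative of the gain. -/
structure GainSystem where
  A : Matrix (Fin 2) (Fin 2) ℝ
  b : Fin 2 → ℝ
  c : Fin 2 → ℝ
  δmin : ℝ → ℝ
  δmax : ℝ → ℝ

namespace GainSystem

/-! ### The closed loop and its absolute stability -/

/-- Admissible feedback gain: `κ` is continuously differentiable on `[0, ∞)`, takes values in
`[0, 1]`, and `δmin (κ t) ≤ κ'(t) ≤ δmax (κ t)` for all `t ≥ 0` (one-sided derivative at `0`). -/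
structure IsAdmissibleGain (S : GainSystem) (κ : ℝ → ℝ) : Prop where
  contDiffOn : ContDiffOn ℝ 1 κ (Ici 0)
  mem_Icc : ∀ t, 0 ≤ t → κ t ∈ Icc (0 : ℝ) 1
  le_deriv : ∀ t, 0 ≤ t → S.δmin (κ t) ≤ derivWithin κ (Ici 0) t
  deriv_le : ∀ t, 0 ≤ t → derivWithin κ (Ici 0) t ≤ S.δmax (κ t)

/-- The right-hand side `A x + b u` with `u = k y`, `y = cᵀ x`. -/
def closedLoop (S : GainSystem) (k : ℝ) (x : EuclideanSpace ℝ (Fin 2)) :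
    EuclideanSpace ℝ (Fin 2) :=
  WithLp.toLp 2 (S.A *ᵥ x.ofLp + (k * (S.c ⬝ᵥ x.ofLp)) • S.b)

/-- `x` is a solution on `[t₀, ∞)` of the closed loop with feedback gain `κ`. -/
def IsSolution (S : GainSystem) (κ : ℝ → ℝ) (t₀ : ℝ) (x : ℝ → EuclideanSpace ℝ (Fin 2)) : Prop :=
  ∀ t, t₀ ≤ t → HasDerivWithinAt x (S.closedLoop (κ t) (x t)) (Ici t₀) t

/-- The zero solution of the closed loop with gain `κ` is globally asymptotically stable:
for every initial time it is Lyapunov stable, and every solution tends to zero. -/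
def IsGloballyAsymptoticallyStable (S : GainSystem) (κ : ℝ → ℝ) : Prop :=
  ∀ t₀, 0 ≤ t₀ →
    (∀ ε : ℝ, 0 < ε → ∃ η : ℝ, 0 < η ∧ ∀ x, S.IsSolution κ t₀ x → ‖x t₀‖ < η →
      ∀ t, t₀ ≤ t → ‖x t‖ < ε) ∧
    (∀ x, S.IsSolution κ t₀ x → Tendsto x atTop (𝓝 0))

/-- Absolute stability: the zero solution is globally asymptotically stable under every
admissible feedback gain. -/
def IsAbsolutelyStable (S : GainSystem) : Prop :=
  ∀ κ, S.IsAdmissibleGain κ → S.IsGloballyAsymptoticallyStable κ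

/-! ### Polar coordinates -/

/-- The radial unit vector `𝐢(θ)`. -/
def radial (θ : ℝ) : Fin 2 → ℝ := ![Real.cos θ, Real.sin θ]

/-- The tangential unit vector `𝐣(θ)`. -/
def tangential (θ : ℝ) : Fin 2 → ℝ := ![-Real.sin θ, Real.cos θ]

/-- `A + κ B` with `B = b cᵀ`. -/
def loopMatrix (S : GainSystem) (κ : ℝ) : Matrix (Fin 2) (Fin 2) ℝ :=
  S.A + κ • Matrix.vecMulVec S.b S.c

/-- `h(κ, θ) = 𝐢(θ)ᵀ (A + κ B) 𝐢(θ)`, so that `dr/dt = h r`. -/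
def h (S : GainSystem) (κ θ : ℝ) : ℝ := radial θ ⬝ᵥ (S.loopMatrix κ *ᵥ radial θ)

/-- `g(κ, θ) = 𝐣(θ)ᵀ (A + κ B) 𝐢(θ)`, so that `dθ/dt = g`. -/
def g (S : GainSystem) (κ θ : ℝ) : ℝ := tangential θ ⬝ᵥ (S.loopMatrix κ *ᵥ radial θ)

/-- `f = h / g`, so that `dr/dθ = f r`. -/
def f (S : GainSystem) (κ θ : ℝ) : ℝ := S.h κ θ / S.g κ θ

/-! ### The Hamilton–Jacobi–Bellman equation -/

/-- Smallest rate `dκ/dt` with which a trajectory that stays in `[0, 1]` can arrive at `κ`. -/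
def νmin (S : GainSystem) (κ : ℝ) : ℝ := if κ = 1 then 0 else S.δmin κ

/-- Largest rate `dκ/dt` with which a trajectory that stays in `[0, 1]` can arrive at `κ`. -/
def νmax (S : GainSystem) (κ : ℝ) : ℝ := if κ = 0 then 0 else S.δmax κ

/-- `min {ν p : νmin κ ≤ ν ≤ νmax κ}`. -/
def minRate (S : GainSystem) (κ p : ℝ) : ℝ :=
  sInf ((fun ν => ν * p) '' Icc (S.νmin κ) (S.νmax κ))

/-- The infimum in `minRate` is a minimum, attained at an endpoint. -/
theorem minRate_eq (S : GainSystem) {κ : ℝ} (p : ℝ) (h₁ : S.δmin κ ≤ 0) (h₂ : 0 ≤ S.δmax κ) :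
    S.minRate κ p = min (S.νmin κ * p) (S.νmax κ * p) := by
  have h1 : S.νmin κ ≤ 0 := by unfold νmin; split_ifs <;> simp [h₁]
  have h2 : 0 ≤ S.νmax κ := by unfold νmax; split_ifs <;> simp [h₂]
  have h12 := h1.trans h2
  refine IsLeast.csInf_eq ⟨?_, ?_⟩
  · rcases min_choice (S.νmin κ * p) (S.νmax κ * p) with e | e <;> rw [e]
    · exact ⟨_, left_mem_Icc.2 h12, rfl⟩
    · exact ⟨_, right_mem_Icc.2 h12, rfl⟩
  · rintro _ ⟨ν, ⟨ha, hb⟩, rfl⟩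
    rcases le_total 0 p with hp | hp
    · exact (min_le_left _ _).trans (mul_le_mul_of_nonneg_right ha hp)
    · exact (min_le_right _ _).trans (mul_le_mul_of_nonpos_right hb hp)

/-- The left side minus the right side of the HJB equation
`φ_θ + (1 / g) min_ν {ν φ_κ} = f φ`, for a `C¹` function `φ (κ, θ)`. The factor `1 / g` is
`dt/dθ`: along trajectories `dκ/dθ = (dκ/dt) / (dθ/dt) = ν / g`. -/
def hjb (S : GainSystem) (φ : ℝ → ℝ → ℝ) (κ θ : ℝ) : ℝ :=
  deriv (fun s => φ κ s) θ + (1 / S.g κ θ) * S.minRate κ (deriv (fun k => φ k θ) κ)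
    - S.f κ θ * φ κ θ

/-- The set `[0, 1] × (0, ∞)` of pairs `(κ, θ)` on which the HJB equation is imposed. -/
def hjbDomain : Set (ℝ × ℝ) := Icc 0 1 ×ˢ Ioi 0

/-- Viscosity subsolution: `hjb ≤ 0` at each point where a `C¹` function touches `ρ` from above. -/
def IsViscositySubsolution (S : GainSystem) (ρ : ℝ → ℝ → ℝ) : Prop :=
  ∀ φ : ℝ → ℝ → ℝ, ContDiff ℝ 1 (fun p : ℝ × ℝ => φ p.1 p.2) →
    ∀ κ θ, (κ, θ) ∈ hjbDomain → φ κ θ = ρ κ θ →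
      (∀ᶠ p in 𝓝[hjbDomain] (κ, θ), ρ p.1 p.2 ≤ φ p.1 p.2) → S.hjb φ κ θ ≤ 0

/-- Viscosity supersolution: `hjb ≥ 0` at each point where a `C¹` function touches `ρ` from
below. -/
def IsViscositySupersolution (S : GainSystem) (ρ : ℝ → ℝ → ℝ) : Prop :=
  ∀ φ : ℝ → ℝ → ℝ, ContDiff ℝ 1 (fun p : ℝ × ℝ => φ p.1 p.2) →
    ∀ κ θ, (κ, θ) ∈ hjbDomain → φ κ θ = ρ κ θ →
      (∀ᶠ p in 𝓝[hjbDomain] (κ, θ), φ p.1 p.2 ≤ ρ p.1 p.2) → 0 ≤ S.hjb φ κ θ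

/-- `ρ (κ, θ)` is a viscosity solution of the HJB equation with the boundary condition
`ρ (κ, 0) = 1`: continuous on `[0, 1] × [0, ∞)`, a sub- and a supersolution. -/
structure IsViscositySolution (S : GainSystem) (ρ : ℝ → ℝ → ℝ) : Prop where
  continuousOn : ContinuousOn (fun p : ℝ × ℝ => ρ p.1 p.2) (Icc 0 1 ×ˢ Ici 0)
  boundary : ∀ κ ∈ Icc (0 : ℝ) 1, ρ κ 0 = 1
  subsolution : S.IsViscositySubsolution ρ
  supersolution : S.IsViscositySupersolution ρ

end GainSystem

end

/-! Put `P = N * π`. Think of `ρ (κ, θ)` as the largest radius with which a trajectory of radius 1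
at angle 0 can arrive at angle `θ` with gain `κ`. For a smooth `ρ` the subsolution inequality says
that at each point some allowed rate `ν` gives `dρ/dt ≤ h ρ` along the motion `(ν, g)`; followed
backwards in time, such rates yield a trajectory along which `ρ / r` does not increase in forward
time. Since `ρ (·, P) > 1` for every final gain, such arcs can be chained backwards, using the
period `P` of the dynamics in the angle, into trajectories of any length whose radius does not
decay.

The function `ρ` is only continuous, so it is regularised. Let `V x` be the maximum over `j ≤ m` and
`s` of `ρ s - a * |s + (0, j P) - x|²`. At a maximiser a quadratic test function touches `ρ` from
above and the equation supplies a rate. Keeping the same maximiser as a competitor after a backward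
Euler step bounds the change of `V` (`exists_sup_convolution`). Taking the maximum over all shifted
copies replaces the gluing of arcs: because `ρ (κ, t) < ρ (κ, t + P)` for small `t`, a copy `j ≥ 1`
loses to copy `j - 1` near its own initial line, so a maximiser never lies where the equation is not
imposed. Comparing `V ≤ 11/10` at the bottom with `V ≥ 9/10` just above each angle `j P` keeps the
radius above `e⁻¹` there (`exists_discreteTrajectory`).

An ultrafilter limit of finer and longer discrete trajectories is an exact polar solution on `[0,
∞)` which returns to radius at least `e⁻¹` at arbitrarily late times (`exists_relaxed_trajectory`).
Its gain is merely Lipschitz and obeys the rate bounds as Dini inequalities.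

To get a `C¹` gain, values at times `log n / K` are joined by monotone admissible arcs, run on a
clock that stops at the junctions (`IsRelaxedGain.exists_admissible`). Both the error of the gain
and the loss of the clock are integrable against `e ^ (2 C t)`, which is strong enough for variation
of constants to transfer convergence to zero (`tendsto_zero_of_linear_perturbation`). If the
admissible gain made all solutions tend to zero, the limit trajectory would do so as well, a
contradiction. -/

noncomputable section



/-! ### Linear differential equations -/

/-- Global existence for a linear differential equation with continuous bounded coefficients. -/
theorem exists_hasDerivAt_linear {F : Type*} [NormedAddCommGroup F] [NormedSpace ℝ F]
    [CompleteSpace F] {L : ℝ → F →L[ℝ] F} (hL : Continuous L) {C : ℝ} (hC : ∀ t, ‖L t‖ ≤ C)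
    (x₀ : F) :
    ∃ x : ℝ → F, x 0 = x₀ ∧ ∀ t, 0 ≤ t → HasDerivAt x (L t (x t)) t := by
  have hC0 : 0 ≤ C := (norm_nonneg _).trans (hC 0)
  -- In the unknown `u t = exp (-lam t) • x t` the Picard operator is a contraction on the whole
  -- half-line, with constant `C / lam < 1`.
  set lam : ℝ := C + 1 with hlam
  have hlam0 : 0 < lam := by positivity
  have hcont : ∀ u : BoundedContinuousFunction ℝ F,
      Continuous fun s => Real.exp (lam * s) • L s (u s) := fun u =>
    (by fun_prop : Continuous fun s : ℝ => Real.exp (lam * s)).smul (hL.clm_apply u.continuous)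
  have hexp : ∀ T : ℝ, ∫ s in (0 : ℝ)..T, Real.exp (lam * s) = (Real.exp (lam * T) - 1) / lam := by
    intro T
    rw [intervalIntegral.integral_comp_mul_left _ hlam0.ne']
    simp [integral_exp]
    field_simp
  have hint : ∀ (u : BoundedContinuousFunction ℝ F) (T : ℝ), 0 ≤ T →
      ‖∫ s in (0 : ℝ)..T, Real.exp (lam * s) • L s (u s)‖
        ≤ C * ‖u‖ * ((Real.exp (lam * T) - 1) / lam) := by
    intro u T hT
    rw [← hexp, ← intervalIntegral.integral_const_mul]
    refine intervalIntegral.norm_integral_le_of_norm_le hT (Eventually.of_forall fun s _ => ?_)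
      (Continuous.intervalIntegrable (by fun_prop) _ _)
    rw [norm_smul, Real.norm_of_nonneg (Real.exp_pos _).le, mul_comm]
    refine mul_le_mul_of_nonneg_right ?_ (Real.exp_pos _).le
    exact ((L s).le_opNorm _).trans (mul_le_mul (hC s) (u.norm_coe_le_norm s) (norm_nonneg _) hC0)
  have hscale : ∀ (u : BoundedContinuousFunction ℝ F) (T : ℝ), 0 ≤ T →
      ‖Real.exp (-(lam * T)) • ∫ s in (0 : ℝ)..T, Real.exp (lam * s) • L s (u s)‖
        ≤ C / lam * ‖u‖ := by
    intro u T hT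
    rw [norm_smul, Real.norm_of_nonneg (Real.exp_pos _).le]
    refine (mul_le_mul_of_nonneg_left (hint u T hT) (Real.exp_pos _).le).trans ?_
    have h1 : Real.exp (-(lam * T)) * Real.exp (lam * T) = 1 := by
      rw [← Real.exp_add]; simp
    have h2 : Real.exp (-(lam * T)) * (C * ‖u‖ * ((Real.exp (lam * T) - 1) / lam))
        = C / lam * ‖u‖ * (Real.exp (-(lam * T)) * Real.exp (lam * T) - Real.exp (-(lam * T))) := by
      field_simp
    rw [h2, h1]
    have h3 := Real.exp_pos (-(lam * T))
    have h4 : 0 ≤ C / lam * ‖u‖ := by positivity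
    nlinarith
  -- The Picard operator for `u`; `max t 0` freezes it on negative times so that it acts on bounded
  -- functions on all of `ℝ`.
  let G : BoundedContinuousFunction ℝ F → ℝ → F := fun u t =>
    Real.exp (-(lam * max t 0)) •
      (x₀ + ∫ s in (0 : ℝ)..(max t 0), Real.exp (lam * s) • L s (u s))
  have hGc : ∀ u, Continuous (G u) := by
    intro u
    have h1 : Continuous fun T : ℝ => ∫ s in (0 : ℝ)..T, Real.exp (lam * s) • L s (u s) :=
      intervalIntegral.continuous_primitive (fun _ _ => (hcont u).intervalIntegrable _ _) 0
    have h2 : Continuous fun t : ℝ => max t 0 := by fun_prop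
    exact (by fun_prop : Continuous fun t : ℝ => Real.exp (-(lam * max t 0))).smul
      (continuous_const.add (h1.comp h2))
  have hGb : ∀ u t, ‖G u t‖ ≤ ‖x₀‖ + C / lam * ‖u‖ := by
    intro u t
    have h0 : (0 : ℝ) ≤ max t 0 := le_max_right _ _
    simp only [G, smul_add]
    refine (norm_add_le _ _).trans (add_le_add ?_ (hscale u _ h0))
    rw [norm_smul, Real.norm_of_nonneg (Real.exp_pos _).le]
    refine mul_le_of_le_one_left (norm_nonneg _) (Real.exp_le_one_iff.2 ?_)
    nlinarith
  let T : BoundedContinuousFunction ℝ F → BoundedContinuousFunction ℝ F := fun u =>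
    BoundedContinuousFunction.ofNormedAddCommGroup (G u) (hGc u) _ (hGb u)
  have hK : Real.toNNReal (C / lam) < 1 := by
    rw [Real.toNNReal_lt_one, div_lt_one hlam0]
    linarith
  have hT : ContractingWith (Real.toNNReal (C / lam)) T := by
    refine ⟨hK, LipschitzWith.of_dist_le_mul fun u v => ?_⟩
    rw [Real.coe_toNNReal _ (by positivity)]
    rw [BoundedContinuousFunction.dist_le (by positivity)]
    intro t
    have h0 : (0 : ℝ) ≤ max t 0 := le_max_right _ _
    have h1 : T u t - T v t = Real.exp (-(lam * max t 0)) •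
        ∫ s in (0 : ℝ)..(max t 0), Real.exp (lam * s) • L s ((u - v) s) := by
      change G u t - G v t = _
      simp only [G]
      rw [← smul_sub, add_sub_add_left_eq_sub, ← intervalIntegral.integral_sub
        ((hcont u).intervalIntegrable _ _) ((hcont v).intervalIntegrable _ _)]
      simp [smul_sub]
    rw [dist_eq_norm, h1, dist_eq_norm]
    exact hscale (u - v) _ h0
  obtain ⟨u, hu⟩ : ∃ u, T u = u := ⟨_, hT.fixedPoint_isFixedPt⟩
  let x : ℝ → F := fun t => x₀ + ∫ s in (0 : ℝ)..t, Real.exp (lam * s) • L s (u s)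
  have hx : ∀ t, 0 ≤ t → x t = Real.exp (lam * t) • u t := by
    intro t ht
    have h1 : u t = G u t := (DFunLike.congr_fun hu t).symm
    rw [h1]
    simp only [G, x, max_eq_left ht, smul_smul, ← Real.exp_add]
    simp
  refine ⟨x, by simp [x], fun t ht => ?_⟩
  have h1 : HasDerivAt x (Real.exp (lam * t) • L t (u t)) t :=
    (intervalIntegral.integral_hasDerivAt_right ((hcont u).intervalIntegrable _ _)
      ((hcont u).stronglyMeasurableAtFilter _ _) (hcont u).continuousAt).const_add x₀
  rwa [hx t ht, map_smul]

/-- Exponential bound for solutions of a linear differential equation. -/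
theorem norm_le_exp_mul_of_hasDerivWithinAt {F : Type*} [NormedAddCommGroup F] [NormedSpace ℝ F]
    {x x' : ℝ → F} {C : ℝ} (hx : ∀ t, 0 ≤ t → HasDerivWithinAt x (x' t) (Ici 0) t)
    (hC : ∀ t, 0 ≤ t → ‖x' t‖ ≤ C * ‖x t‖) {t : ℝ} (ht : 0 ≤ t) :
    ‖x t‖ ≤ ‖x 0‖ * Real.exp (C * t) := by
  have h := norm_le_gronwallBound_of_norm_deriv_right_le (f := x) (f' := x') (δ := ‖x 0‖) (K := C)
    (ε := 0) (a := 0) (b := t) (fun s hs => (hx s hs.1).continuousWithinAt.mono Icc_subset_Ici_self)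
    (fun s hs => (hx s hs.1).mono (Ici_subset_Ici.2 hs.1)) le_rfl
    (fun s hs => by simpa using hC s hs.1) t ⟨ht, le_rfl⟩
  simpa [gronwallBound_ε0] using h

/-- If two linear systems differ by an integrable amount with respect to the weight `e ^ (2 C t)`,
and all solutions of the first one tend to zero, then so do the solutions of the second one. -/
theorem tendsto_zero_of_linear_perturbation {E : Type*} [NormedAddCommGroup E] [NormedSpace ℝ E]
    [FiniteDimensional ℝ E] {M N : ℝ → E →L[ℝ] E} (hM : Continuous M)
    {C : ℝ} (hMC : ∀ t, ‖M t‖ ≤ C) (hNC : ∀ t, 0 ≤ t → ‖N t‖ ≤ C) {w : ℝ → ℝ}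
    (hw : Continuous w) (hMN : ∀ t, 0 ≤ t → ‖N t - M t‖ ≤ w t) {R : ℝ}
    (hR : ∀ t, 0 ≤ t → ∫ s in (0 : ℝ)..t, Real.exp (2 * C * s) * w s ≤ R)
    (hstab : ∀ x : ℝ → E,
      (∀ t, 0 ≤ t → HasDerivWithinAt x (M t (x t)) (Ici 0) t) → Tendsto x atTop (𝓝 0))
    {X : ℝ → E}
    (hX : ∀ t, 0 ≤ t → HasDerivWithinAt X (N t (X t)) (Ici 0) t) : Tendsto X atTop (𝓝 0) := by
  have hC0 : 0 ≤ C := (norm_nonneg _).trans (hMC 0)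
  have : CompleteSpace E := FiniteDimensional.complete ℝ E
  let b := Module.finBasis ℝ E
  let mulL : (E →L[ℝ] E) →L[ℝ] (E →L[ℝ] E) →L[ℝ] (E →L[ℝ] E) := ContinuousLinearMap.mul ℝ (E →L[ℝ] E)
  -- `Φ` is the fundamental solution; `Ψ` solves `Ψ' = -Ψ M`, so `Ψ Φ` is constant and `Ψ` is the
  -- inverse of `Φ`, with its own exponential bound.
  obtain ⟨Φ, hΦ0, hΦ⟩ := exists_hasDerivAt_linear (L := fun t => mulL (M t)) (by fun_prop) (C := C)
    (fun t => (ContinuousLinearMap.opNorm_mul_apply_le ℝ _ _).trans (hMC t)) 1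
  obtain ⟨Ψ, hΨ0, hΨ⟩ := exists_hasDerivAt_linear (L := fun t => -mulL.flip (M t)) (by fun_prop)
    (C := C) (fun t => by
      rw [norm_neg]
      refine ContinuousLinearMap.opNorm_le_bound _ hC0 fun Y => ?_
      refine (norm_mul_le _ _).trans ?_
      rw [mul_comm]
      exact mul_le_mul_of_nonneg_right (hMC t) (norm_nonneg _)) 1
  have hΦ' : ∀ t, 0 ≤ t → HasDerivAt Φ (M t * Φ t) t := hΦ
  have hΨ' : ∀ t, 0 ≤ t → HasDerivAt Ψ (-(Ψ t * M t)) t := hΨ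
  have hone : ∀ t, 0 ≤ t → Φ t * Ψ t = 1 := by
    intro t ht
    have h1 : Ψ t * Φ t = 1 := by
      have hd : ∀ s, 0 ≤ s → HasDerivAt (fun r => Ψ r * Φ r) 0 s := fun s hs => by
        have h := (hΨ' s hs).mul (hΦ' s hs)
        rwa [neg_mul, mul_assoc, neg_add_cancel] at h
      have := constant_of_has_deriv_right_zero (f := fun r => Ψ r * Φ r) (a := 0) (b := t)
        (fun s hs => (hd s hs.1).continuousAt.continuousWithinAt)
        (fun s hs => (hd s hs.1).hasDerivWithinAt) t ⟨ht, le_rfl⟩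
      simpa [hΦ0, hΨ0] using this
    have h2 : (Ψ t : E →ₗ[ℝ] E) * (Φ t : E →ₗ[ℝ] E) = 1 := by
      ext1 v
      exact congrArg (fun Z : E →L[ℝ] E => Z v) h1
    -- In finite dimension a left inverse is a right inverse.
    rw [mul_eq_one_comm] at h2
    ext1 v
    exact congrArg (fun Z : E →ₗ[ℝ] E => Z v) h2
  have hΨn : ∀ t, 0 ≤ t → ‖Ψ t‖ ≤ Real.exp (C * t) := by
    intro t ht
    refine (norm_le_exp_mul_of_hasDerivWithinAt (fun s hs => (hΨ' s hs).hasDerivWithinAt) (C := C)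
      (fun s hs => ?_) ht).trans ?_
    · rw [norm_neg, mul_comm]
      exact (norm_mul_le _ _).trans (mul_le_mul_of_nonneg_left (hMC s) (norm_nonneg _))
    · rw [hΨ0]
      exact mul_le_of_le_one_left (Real.exp_pos _).le ContinuousLinearMap.norm_id_le
  have hXn : ∀ t, 0 ≤ t → ‖X t‖ ≤ ‖X 0‖ * Real.exp (C * t) := fun t ht =>
    norm_le_exp_mul_of_hasDerivWithinAt hX
      (fun s hs => (ContinuousLinearMap.le_opNorm _ _).trans
        (mul_le_mul_of_nonneg_right (hNC s hs) (norm_nonneg _))) ht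
  -- Variation of constants: the terms with `M` cancel in `y'`, leaving `Ψ (N - M) X`, of norm at
  -- most `‖X 0‖ e ^ (2 C t) w t`. Hence `y` stays bounded.
  let y : ℝ → E := fun t => Ψ t (X t)
  have hy : ∀ t, 0 ≤ t → HasDerivWithinAt y (Ψ t ((N t - M t) (X t))) (Ici 0) t := by
    intro t ht
    have := (hΨ' t ht).hasDerivWithinAt (s := Ici 0) |>.clm_apply (hX t ht)
    convert this using 1
    simp [ContinuousLinearMap.mul_def]
    abel
  have hyb : ∀ t, 0 ≤ t → ‖y t‖ ≤ ‖y 0‖ + ‖X 0‖ * R := by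
    intro t ht
    have hwc : Continuous fun s => Real.exp (2 * C * s) * w s := by fun_prop
    have := image_norm_le_of_norm_deriv_right_le_deriv_boundary (f := y) (a := 0) (b := t)
      (f' := fun t => Ψ t ((N t - M t) (X t)))
      (B := fun t => ‖y 0‖ + ‖X 0‖ * ∫ s in (0 : ℝ)..t, Real.exp (2 * C * s) * w s)
      (B' := fun t => ‖X 0‖ * (Real.exp (2 * C * t) * w t))
      (fun s hs => (hy s hs.1).continuousWithinAt.mono Icc_subset_Ici_self)
      (fun s hs => (hy s hs.1).mono (Ici_subset_Ici.2 hs.1)) (by simp)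
      (fun s => ((intervalIntegral.integral_hasDerivAt_right (hwc.intervalIntegrable _ _)
        (hwc.stronglyMeasurableAtFilter _ _) hwc.continuousAt).const_mul _).const_add _)
      (fun s hs => ?_) ⟨ht, le_rfl⟩
    · refine this.trans ?_
      gcongr
      exact hR t ht
    · have e : Real.exp (2 * C * s) = Real.exp (C * s) * Real.exp (C * s) := by
        rw [← Real.exp_add]; ring_nf
      calc ‖Ψ s ((N s - M s) (X s))‖ ≤ ‖Ψ s‖ * (‖N s - M s‖ * ‖X s‖) :=
            (ContinuousLinearMap.le_opNorm _ _).trans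
              (mul_le_mul_of_nonneg_left (ContinuousLinearMap.le_opNorm _ _) (norm_nonneg _))
        _ ≤ Real.exp (C * s) * (w s * (‖X 0‖ * Real.exp (C * s))) := by
            have := hΨn s hs.1
            have h2 := hXn s hs.1
            have h3 := hMN s hs.1
            have h4 : 0 ≤ w s := (norm_nonneg _).trans h3
            gcongr
        _ = _ := by rw [e]; ring
  -- Bounded coordinates times solutions of the first system, each of which tends to zero.
  have hXy : ∀ t, 0 ≤ t → X t = ∑ i, b.repr (y t) i • Φ t (b i) := by
    intro t ht
    have h1 : X t = Φ t (y t) := by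
      have := congrArg (fun Z : E →L[ℝ] E => Z (X t)) (hone t ht)
      simpa using this.symm
    have h2 : y t = ∑ i, b.repr (y t) i • b i := (b.sum_repr (y t)).symm
    rw [h1]
    conv_lhs => rw [h2]
    simp only [map_sum, map_smul]
  have hsum : Tendsto (fun t => ∑ i, b.repr (y t) i • Φ t (b i)) atTop
      (𝓝 (∑ _i : Fin (Module.finrank ℝ E), (0 : E))) := by
    refine tendsto_finsetSum _ fun i _ => ?_
    refine Filter.IsBoundedUnder.smul_tendsto_zero ?_ ?_
    · let c : E →L[ℝ] ℝ := LinearMap.toContinuousLinearMap (b.coord i)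
      refine ⟨‖c‖ * (‖y 0‖ + ‖X 0‖ * R), ?_⟩
      rw [eventually_map]
      filter_upwards [eventually_ge_atTop 0] with t ht
      exact (c.le_opNorm (y t)).trans (mul_le_mul_of_nonneg_left (hyb t ht) (norm_nonneg _))
    · refine hstab _ fun t ht => HasDerivAt.hasDerivWithinAt ?_
      have := (hΦ' t ht).clm_apply (hasDerivAt_const t (b i))
      simpa using this
  rw [Finset.sum_const_zero] at hsum
  refine hsum.congr' ?_
  filter_upwards [eventually_ge_atTop 0] with t ht
  rw [hXy t ht]

/-! ### A continuous bump around a countable closed set -/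

/-- The set is null for the measure with density `W`, so outer regularity encloses it in an open set
of measure below 1; Urysohn's lemma then gives a bump supported there. It will serve to stop a clock
on `G` at negligible cost. -/
theorem exists_continuous_eq_one_integral_le {G : Set ℝ} (hG : IsClosed G) (hGc : G.Countable)
    {W : ℝ → ℝ} (hW : Continuous W) (hW0 : ∀ t, 0 ≤ W t) :
    ∃ σ : ℝ → ℝ, Continuous σ ∧ (∀ t, σ t ∈ Icc (0 : ℝ) 1) ∧ (∀ t ∈ G, σ t = 1) ∧
      ∀ t, 0 ≤ t → ∫ s in (0 : ℝ)..t, W s * σ s ≤ 1 := by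
  let μ : MeasureTheory.Measure ℝ :=
    MeasureTheory.volume.withDensity fun s => ENNReal.ofReal (W s)
  have hGμ : μ G = 0 := MeasureTheory.withDensity_absolutelyContinuous _ _
    (hGc.measure_zero MeasureTheory.volume)
  have : MeasureTheory.IsLocallyFiniteMeasure μ :=
    MeasureTheory.IsLocallyFiniteMeasure.withDensity_ofReal hW
  obtain ⟨U, hGU, hU, hμU⟩ := G.exists_isOpen_lt_of_lt (μ := μ) 1 (by rw [hGμ]; exact one_pos)
  obtain ⟨φ, hφ0, hφ1, hφ⟩ := exists_continuous_zero_one_of_isClosed hU.isClosed_compl hG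
    (disjoint_compl_left_iff_subset.2 hGU)
  refine ⟨φ, φ.continuous, hφ, fun t ht => hφ1 ht, fun t ht => ?_⟩
  have hc : Continuous fun s => W s * φ s := hW.mul φ.continuous
  rw [intervalIntegral.integral_of_le ht,
    MeasureTheory.integral_eq_lintegral_of_nonneg_ae
      (Eventually.of_forall fun s => mul_nonneg (hW0 s) (hφ s).1) hc.aestronglyMeasurable]
  refine ENNReal.toReal_le_of_le_ofReal zero_le_one ?_
  rw [ENNReal.ofReal_one]
  refine le_trans ?_ hμU.le
  rw [MeasureTheory.withDensity_apply _ hU.measurableSet,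
    ← MeasureTheory.lintegral_indicator hU.measurableSet]
  refine (MeasureTheory.lintegral_mono_set (t := univ) (subset_univ _)).trans ?_
  rw [MeasureTheory.Measure.restrict_univ]
  refine MeasureTheory.lintegral_mono fun s => ?_
  by_cases hs : s ∈ U
  · rw [indicator_of_mem hs]
    exact ENNReal.ofReal_le_ofReal (mul_le_of_le_one_right (hW0 s) (hφ s).2)
  · rw [indicator_of_notMem hs, hφ0 hs]; simp




/-! ### Limits along an ultrafilter -/

theorem Ultrafilter.exists_tendsto_of_abs_le {ι : Type*} (U : Ultrafilter ι) {f : ι → ℝ} {C : ℝ}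
    (hf : ∀ᶠ n in U, |f n| ≤ C) : ∃ x, Tendsto f U (𝓝 x) := by
  obtain ⟨x, -, hx⟩ := (isCompact_Icc (a := -C) (b := C)).ultrafilter_le_nhds (U.map f) (by
    rw [le_principal_iff]
    exact hf.mono fun n hn => abs_le.1 hn)
  exact ⟨x, hx⟩

/-- The mean value inequality for `f n v - c v` has a constant independent of `n` on a small ball,
so it survives the pointwise limit. -/
theorem hasDerivAt_of_tendsto_of_hasDerivAt_near {ι : Type*} {l : Filter ι} [l.NeBot]
    {f f' : ι → ℝ → ℝ} {F : ℝ → ℝ} {u c : ℝ} (hf : ∀ n v, HasDerivAt (f n) (f' n v) v)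
    (hF : ∀ v, Tendsto (fun n => f n v) l (𝓝 (F v)))
    (hc : ∀ η > 0, ∃ d > 0, ∀ᶠ n in l, ∀ v, |v - u| < d → |f' n v - c| ≤ η) :
    HasDerivAt F c u := by
  rw [hasDerivAt_iff_isLittleO, Asymptotics.isLittleO_iff]
  intro η hη
  obtain ⟨d, hd, h⟩ := hc η hη
  filter_upwards [Metric.ball_mem_nhds u hd] with v hv
  have h1 : ∀ᶠ n in l, ‖f n v - f n u - (v - u) • c‖ ≤ η * ‖v - u‖ := by
    filter_upwards [h] with n hn
    have := (convex_ball u d).norm_image_sub_le_of_norm_hasDerivWithin_le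
      (f := fun x => f n x - x * c) (f' := fun x => f' n x - c) (C := η)
      (fun x _ => by
        have h1 := (hf n x).sub ((hasDerivAt_id x).mul_const c)
        rw [one_mul] at h1
        exact h1.hasDerivWithinAt)
      (fun x hx => hn x (by simpa [Real.dist_eq] using hx)) (Metric.mem_ball_self hd) hv
    have e : f n v - f n u - (v - u) • c = f n v - v * c - (f n u - u * c) := by
      rw [smul_eq_mul]; ring
    rwa [e]
  have h2 : Tendsto (fun n => ‖f n v - f n u - (v - u) • c‖) l
      (𝓝 ‖F v - F u - (v - u) • c‖) := (((hF v).sub (hF u)).sub_const _).norm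
  exact le_of_tendsto h2 h1

/-! ### Monotone connections -/

/-- Global solution of a scalar autonomous equation with a positive continuous right-hand side. -/
theorem exists_hasDerivAt_of_pos {F : ℝ → ℝ} (hF : Continuous F) (hF0 : ∀ k, 0 < F k) {L : ℝ}
    (hL : ∀ k, F k ≤ L) (a : ℝ) : ∃ m : ℝ → ℝ, m 0 = a ∧ ∀ u, HasDerivAt m (F (m u)) u := by
  have hL0 : 0 < L := (hF0 0).trans_le (hL 0)
  have hc : Continuous fun k => (F k)⁻¹ := hF.inv₀ fun k => (hF0 k).ne'
  -- Separation of variables: `T k` is the time at which the solution reaches `k`. Since `T' ≥ 1 /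
  -- L`, it is onto `ℝ`, and its inverse is the solution.
  let T : ℝ → ℝ := fun k => ∫ x in a..k, (F x)⁻¹
  have hT : ∀ k, HasDerivAt T (F k)⁻¹ k := fun k =>
    intervalIntegral.integral_hasDerivAt_right (hc.intervalIntegrable _ _)
      (hc.stronglyMeasurableAtFilter _ _) hc.continuousAt
  have hmono : StrictMono T := strictMono_of_deriv_pos fun k => by
    rw [(hT k).deriv]; exact inv_pos.2 (hF0 k)
  have hlin : Monotone fun k => T k - L⁻¹ * k := by
    refine monotone_of_deriv_nonneg (fun k => ?_) fun k => ?_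
    · exact ((hT k).sub ((hasDerivAt_id k).const_mul _)).differentiableAt
    · have := ((hT k).sub ((hasDerivAt_id k).const_mul L⁻¹)).deriv
      simp only [id, mul_one] at this
      change 0 ≤ deriv (T - fun k => L⁻¹ * k) k
      rw [this, sub_nonneg]
      exact inv_anti₀ (hF0 k) (hL k)
  have hTa : T a = 0 := by simp [T]
  have hsurj : Function.Surjective T := by
    refine Continuous.surjective (continuous_iff_continuousAt.2 fun k => (hT k).continuousAt) ?_ ?_
    · refine tendsto_atTop_mono' _ (f₁ := fun k => L⁻¹ * k + -(L⁻¹ * a)) ?_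
        (tendsto_atTop_add_const_right _ _ (tendsto_id.const_mul_atTop (inv_pos.2 hL0)))
      filter_upwards [eventually_ge_atTop a] with k hk
      have := hlin hk
      simp only [hTa] at this
      linarith
    · refine tendsto_atBot_mono' _ (f₁ := fun k => L⁻¹ * k + -(L⁻¹ * a)) ?_
        (tendsto_atBot_add_const_right _ _ (tendsto_id.const_mul_atBot (inv_pos.2 hL0)))
      filter_upwards [eventually_le_atBot a] with k hk
      have := hlin hk
      simp only [hTa] at this
      linarith
  let e := hmono.orderIsoOfSurjective T hsurj
  have he : ∀ y, T (e.symm y) = y := fun y => e.apply_symm_apply y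
  refine ⟨e.symm, ?_, fun u => ?_⟩
  · exact hmono.injective (by rw [he, hTa])
  · have := HasDerivAt.of_local_left_inverse (f := T) (g := e.symm) (a := u)
      e.symm.continuous.continuousAt (hT _) (inv_ne_zero (hF0 _).ne') (Eventually.of_forall he)
    rwa [inv_inv] at this

/-- If the upper right derivative of `κ` is at most `D (κ)`, then an increment of `κ` can also be
realised by a solution of `m' = lam * D (m)`. -/
theorem exists_hasDerivAt_connection {D : ℝ → ℝ} (hD : Continuous D) (hD0 : ∀ k, 0 ≤ D k) {L : ℝ}
    (hL : ∀ k, D k ≤ L) {κ : ℝ → ℝ} {s t : ℝ} (hst : s < t) (hκ : ContinuousOn κ (Icc s t))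
    (hrate : ∀ u ∈ Ico s t, ∀ η > 0, ∀ᶠ v in 𝓝[>] u, κ v - κ u ≤ (v - u) * (D (κ u) + η))
    (hle : κ s ≤ κ t) :
    ∃ (m : ℝ → ℝ) (lam : ℝ), lam ∈ Icc (0 : ℝ) 1 ∧ m s = κ s ∧ m t = κ t ∧
      ∀ u, HasDerivAt m (lam * D (m u)) u := by
  have hts : 0 < t - s := sub_pos.2 hst
  have hL0 : 0 ≤ L := (hD0 0).trans (hL 0)
  -- `D` may vanish and need not be Lipschitz. The margin `η` makes the right-hand side positive and
  -- the comparison with `κ` strict.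
  have key : ∀ η > 0, ∃ (m : ℝ → ℝ) (lam : ℝ), lam ∈ Icc (0 : ℝ) 1 ∧ m s = κ s ∧ m t = κ t ∧
      ∀ u, HasDerivAt m (lam * (D (m u) + η)) u := by
    intro η hη
    obtain ⟨m, hm0, hm⟩ := exists_hasDerivAt_of_pos (F := fun k => D k + η) (by fun_prop)
      (fun k => add_pos_of_nonneg_of_pos (hD0 k) hη) (fun k => add_le_add_left (hL k) η) (κ s)
    have hms : ∀ u, HasDerivAt (fun u => m (u - s)) (D (m (u - s)) + η) u := fun u => by
      simpa using (hm (u - s)).comp_sub_const u s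
    have hcmp : κ t ≤ m (t - s) := by
      refine image_le_of_liminf_slope_right_lt_deriv_boundary (f' := fun u => D (κ u)) hκ
        (fun u hu r hr => ?_) (by simp [hm0]) hms (fun u _ h => ?_) (right_mem_Icc.2 hst.le)
      · have hη' : 0 < (r - D (κ u)) / 2 := by linarith
        refine Eventually.frequently ?_
        filter_upwards [hrate u hu _ hη', self_mem_nhdsWithin] with v hv hv'
        have h1 : 0 < v - u := sub_pos.2 hv'
        rw [slope_def_field, div_lt_iff₀ h1]
        nlinarith
      · rw [← h]; linarith
    have hmc : Continuous m := continuous_iff_continuousAt.2 fun u => (hm u).continuousAt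
    -- At full speed `m` arrives at `κ t` after a time `τ ≤ t - s`; slowing it by the factor `τ / (t
    -- - s)` makes it arrive exactly on time.
    obtain ⟨τ, hτ, hτm⟩ := intermediate_value_Icc hts.le hmc.continuousOn
      (show κ t ∈ Icc (m 0) (m (t - s)) from ⟨by rwa [hm0], hcmp⟩)
    refine ⟨fun u => m (τ / (t - s) * (u - s)), τ / (t - s),
      ⟨div_nonneg hτ.1 hts.le, (div_le_one hts).2 hτ.2⟩, by simp [hm0], ?_, fun u => ?_⟩
    · simp only []
      rw [div_mul_cancel₀ _ hts.ne', hτm]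
    · have h1 : HasDerivAt (fun u : ℝ => τ / (t - s) * (u - s)) (τ / (t - s)) u := by
        simpa using ((hasDerivAt_id u).sub_const s).const_mul (τ / (t - s))
      have := (hm (τ / (t - s) * (u - s))).comp u h1
      rwa [mul_comm] at this
  have hpos : ∀ n : ℕ, (0 : ℝ) < 1 / ((n : ℝ) + 1) := fun n => by positivity
  choose m lam hlam hms hmt hm using fun n : ℕ => key (1 / ((n : ℝ) + 1)) (hpos n)
  -- Now `η → 0`: the solutions are equi-Lipschitz and agree at `s`, so an ultrafilter selects
  -- limits of all values and of the slowing factors at once.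
  let U : Ultrafilter ℕ := hyperfilter ℕ
  have hU : (U : Filter ℕ) ≤ atTop := Nat.hyperfilter_le_atTop
  have hη : Tendsto (fun n : ℕ => 1 / ((n : ℝ) + 1)) U (𝓝 0) :=
    tendsto_one_div_add_atTop_nhds_zero_nat.mono_left hU
  have hder : ∀ n u, |lam n * (D (m n u) + 1 / ((n : ℝ) + 1))| ≤ L + 1 := by
    intro n u
    have h1 : 1 / ((n : ℝ) + 1) ≤ 1 := by
      rw [div_le_one (by positivity)]; linarith [n.cast_nonneg (α := ℝ)]
    rw [abs_mul, abs_of_nonneg (hlam n).1, abs_of_pos (add_pos_of_nonneg_of_pos (hD0 _) (hpos n))]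
    have h2 := hD0 (m n u)
    have h3 := hL (m n u)
    have h4 := hpos n
    nlinarith [(hlam n).1, (hlam n).2]
  have hlip : ∀ n u v, |m n v - m n u| ≤ (L + 1) * |v - u| := fun n u v =>
    convex_univ.norm_image_sub_le_of_norm_hasDerivWithin_le
      (fun x _ => (hm n x).hasDerivWithinAt) (fun x _ => hder n x) (mem_univ u) (mem_univ v)
  obtain ⟨l0, hl0⟩ := U.exists_tendsto_of_abs_le (f := lam) (C := 1)
    (Eventually.of_forall fun n => abs_le.2 ⟨by linarith [(hlam n).1], (hlam n).2⟩)
  have hlim : ∀ v, ∃ x, Tendsto (fun n => m n v) U (𝓝 x) := fun v =>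
    U.exists_tendsto_of_abs_le (C := |κ s| + (L + 1) * |v - s|) (Eventually.of_forall fun n => by
      have h1 := hlip n s v
      rw [hms] at h1
      have h2 := abs_add_le (m n v - κ s) (κ s)
      rw [sub_add_cancel] at h2
      linarith)
  choose μ hμ using hlim
  refine ⟨μ, l0, isClosed_Icc.mem_of_tendsto hl0 (Eventually.of_forall hlam), ?_, ?_, fun u => ?_⟩
  · exact tendsto_nhds_unique (hμ s) (by simp [hms])
  · exact tendsto_nhds_unique (hμ t) (by simp [hmt])
  refine hasDerivAt_of_tendsto_of_hasDerivAt_near (l := (U : Filter ℕ)) hm hμ fun η hη0 => ?_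
  have hcont : Continuous fun p : ℝ × ℝ × ℝ => p.1 * (D p.2.1 + p.2.2) := by fun_prop
  obtain ⟨r, hr, hr'⟩ := Metric.continuousAt_iff.1 (hcont.continuousAt (x := (l0, μ u, 0))) η hη0
  refine ⟨r / (2 * (L + 1)), by positivity, ?_⟩
  filter_upwards [hl0 (Metric.ball_mem_nhds _ hr), hμ u (Metric.ball_mem_nhds _ (half_pos hr)),
    hη (Metric.ball_mem_nhds _ hr)] with n h1 h2 h3 v hv
  have h4 : |m n v - m n u| < r / 2 := by
    refine (hlip n u v).trans_lt ?_
    rw [lt_div_iff₀ (by positivity)] at hv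
    linarith
  have h5 : dist (m n v) (μ u) < r := by
    refine (dist_triangle _ (m n u) _).trans_lt ?_
    have h6 : dist (m n u) (μ u) < r / 2 := h2
    rw [Real.dist_eq (m n v)]
    linarith
  have := hr' (x := (lam n, m n v, 1 / ((n : ℝ) + 1)))
    (by rw [Prod.dist_eq, Prod.dist_eq]; exact max_lt h1 (max_lt h5 h3))
  simp only [add_zero] at this
  exact this.le




/-! ### Relaxed gains and their smoothing to admissible gains -/

namespace GainSystem

/-- A gain satisfying the rate constraints in the sense of one-sided Dini derivatives. -/
structure IsRelaxedGain (S : GainSystem) (L : ℝ) (κ : ℝ → ℝ) : Prop where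
  mem_Icc : ∀ t, 0 ≤ t → κ t ∈ Icc (0 : ℝ) 1
  lipschitz : ∀ s t, 0 ≤ s → 0 ≤ t → |κ t - κ s| ≤ L * |t - s|
  upper : ∀ u, 0 ≤ u → ∀ η > 0, ∀ᶠ v in 𝓝[>] u, κ v - κ u ≤ (v - u) * (S.δmax (κ u) + η)
  lower : ∀ u, 0 ≤ u → ∀ η > 0, ∀ᶠ v in 𝓝[>] u, κ u - κ v ≤ (v - u) * (-S.δmin (κ u) + η)

/-- The hypotheses on the rate bounds, with a common bound `L`. -/
structure RateBounds (S : GainSystem) (L : ℝ) : Prop where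
  cont_min : ContinuousOn S.δmin (Icc 0 1)
  cont_max : ContinuousOn S.δmax (Icc 0 1)
  min_nonpos : ∀ κ ∈ Icc (0 : ℝ) 1, S.δmin κ ≤ 0
  max_nonneg : ∀ κ ∈ Icc (0 : ℝ) 1, 0 ≤ S.δmax κ
  le_min : ∀ κ ∈ Icc (0 : ℝ) 1, -L ≤ S.δmin κ
  max_le : ∀ κ ∈ Icc (0 : ℝ) 1, S.δmax κ ≤ L

theorem RateBounds.nonneg {S : GainSystem} {L : ℝ} (h : S.RateBounds L) : 0 ≤ L :=
  (h.max_nonneg 0 (by simp)).trans (h.max_le 0 (by simp))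

/-- Clamping to `[0, 1]`. -/
def clamp (k : ℝ) : ℝ := projIcc (0 : ℝ) 1 zero_le_one k

theorem clamp_mem (k : ℝ) : clamp k ∈ Icc (0 : ℝ) 1 := (projIcc (0 : ℝ) 1 zero_le_one k).2

theorem clamp_of_mem {k : ℝ} (hk : k ∈ Icc (0 : ℝ) 1) : clamp k = k := by
  rw [clamp, projIcc_of_mem _ hk]

theorem continuous_clamp : Continuous clamp :=
  continuous_subtype_val.comp continuous_projIcc

theorem RateBounds.continuous_min {S : GainSystem} {L : ℝ} (h : S.RateBounds L) :
    Continuous fun k => S.δmin (clamp k) :=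
  h.cont_min.comp_continuous continuous_clamp clamp_mem

theorem RateBounds.continuous_max {S : GainSystem} {L : ℝ} (h : S.RateBounds L) :
    Continuous fun k => S.δmax (clamp k) :=
  h.cont_max.comp_continuous continuous_clamp clamp_mem

theorem IsRelaxedGain.continuousOn {S : GainSystem} {L : ℝ} {κ : ℝ → ℝ}
    (hκ : S.IsRelaxedGain L κ) : ContinuousOn κ (Ici 0) := by
  have hL : 0 ≤ L := by
    have := (abs_nonneg _).trans (hκ.lipschitz 0 1 le_rfl zero_le_one)
    simpa using this
  refine LipschitzOnWith.continuousOn (K := L.toNNReal) (LipschitzOnWith.of_dist_le_mul ?_)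
  intro t ht s hs
  rw [Real.coe_toNNReal _ hL, Real.dist_eq, Real.dist_eq]
  exact hκ.lipschitz s t hs ht

/-- Two values of a relaxed gain are joined by an admissible `C¹` piece. -/
theorem IsRelaxedGain.exists_piece {S : GainSystem} {L : ℝ} (hS : S.RateBounds L) {κ : ℝ → ℝ}
    (hκ : S.IsRelaxedGain L κ) {a b : ℝ} (ha : 0 ≤ a) (hab : a ≤ b) :
    ∃ m m' : ℝ → ℝ, Continuous m' ∧ (∀ u, HasDerivAt m (m' u) u) ∧ m a = κ a ∧ m b = κ b ∧
      (∀ u, |m' u| ≤ L) ∧ (∀ u ∈ Icc a b, m u ∈ Icc (0 : ℝ) 1) ∧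
      ∀ u, m u ∈ Icc (0 : ℝ) 1 → S.δmin (m u) ≤ m' u ∧ m' u ≤ S.δmax (m u) := by
  have hb : 0 ≤ b := ha.trans hab
  rcases hab.eq_or_lt with rfl | hlt
  · refine ⟨fun _ => κ a, fun _ => 0, continuous_const, fun u => hasDerivAt_const _ _, rfl, rfl,
      fun _ => by simpa using hS.nonneg, fun _ _ => hκ.mem_Icc a ha, fun _ h => ?_⟩
    exact ⟨hS.min_nonpos _ h, hS.max_nonneg _ h⟩
  have hc : ContinuousOn κ (Icc a b) := hκ.continuousOn.mono fun x hx => ha.trans hx.1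
  rcases le_total (κ a) (κ b) with hle | hle
  · obtain ⟨m, lam, hlam, hma, hmb, hm⟩ := exists_hasDerivAt_connection hS.continuous_max
      (fun k => hS.max_nonneg _ (clamp_mem k)) (fun k => hS.max_le _ (clamp_mem k)) hlt hc
      (fun u hu η hη => by
        rw [clamp_of_mem (hκ.mem_Icc u (ha.trans hu.1))]
        exact hκ.upper u (ha.trans hu.1) η hη) hle
    have hmc : Continuous m := continuous_iff_continuousAt.2 fun u => (hm u).continuousAt
    have hmono : Monotone m := monotone_of_deriv_nonneg (fun u => (hm u).differentiableAt)
      fun u => by rw [(hm u).deriv]; exact mul_nonneg hlam.1 (hS.max_nonneg _ (clamp_mem _))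
    refine ⟨m, fun u => lam * S.δmax (clamp (m u)),
      continuous_const.mul (hS.continuous_max.comp hmc), hm, hma, hmb, fun u => ?_,
      fun u hu => ?_, fun u hu => ?_⟩
    · have h1 := hS.max_nonneg _ (clamp_mem (m u))
      have h2 := hS.max_le _ (clamp_mem (m u))
      rw [abs_of_nonneg (mul_nonneg hlam.1 h1)]
      exact (mul_le_of_le_one_left h1 hlam.2).trans h2
    · exact ⟨(hκ.mem_Icc a ha).1.trans (hma ▸ hmono hu.1),
        (hmono hu.2).trans (hmb ▸ (hκ.mem_Icc b hb).2)⟩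
    · simp only [clamp_of_mem hu]
      have h1 := hS.max_nonneg _ hu
      exact ⟨(hS.min_nonpos _ hu).trans (mul_nonneg hlam.1 h1), mul_le_of_le_one_left h1 hlam.2⟩
  -- The decreasing case is the increasing one for `-κ`, with speed bound `-δmin`.
  · obtain ⟨m, lam, hlam, hma, hmb, hm⟩ := exists_hasDerivAt_connection
      (D := fun k => -S.δmin (clamp (-k))) (κ := fun t => -κ t) (L := L)
      (hS.continuous_min.comp continuous_neg).neg
      (fun k => neg_nonneg.2 (hS.min_nonpos _ (clamp_mem _)))
      (fun k => neg_le.1 (hS.le_min _ (clamp_mem _))) hlt hc.neg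
      (fun u hu η hη => by
        rw [neg_neg, clamp_of_mem (hκ.mem_Icc u (ha.trans hu.1))]
        filter_upwards [hκ.lower u (ha.trans hu.1) η hη] with v hv
        linarith) (neg_le_neg hle)
    have hm' : ∀ u, HasDerivAt (fun u => -m u) (lam * S.δmin (clamp (-m u))) u := fun u => by
      have := (hm u).neg
      rwa [mul_neg, neg_neg] at this
    have hmc : Continuous fun u => -m u :=
      continuous_iff_continuousAt.2 fun u => (hm' u).continuousAt
    have hanti : Antitone fun u => -m u :=
      antitone_of_deriv_nonpos (fun u => (hm' u).differentiableAt) fun u => by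
        rw [(hm' u).deriv]
        exact mul_nonpos_of_nonneg_of_nonpos hlam.1 (hS.min_nonpos _ (clamp_mem _))
    have hma' : -m a = κ a := by rw [hma, neg_neg]
    have hmb' : -m b = κ b := by rw [hmb, neg_neg]
    refine ⟨fun u => -m u, fun u => lam * S.δmin (clamp (-m u)),
      continuous_const.mul (hS.continuous_min.comp hmc), hm', hma', hmb',
      fun u => ?_, fun u hu => ?_, fun u hu => ?_⟩
    · have h1 := hS.min_nonpos _ (clamp_mem (-m u))
      have h2 := hS.le_min _ (clamp_mem (-m u))
      simp only []
      rw [abs_of_nonpos (mul_nonpos_of_nonneg_of_nonpos hlam.1 h1)]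
      nlinarith [hlam.1, hlam.2]
    · exact ⟨(hκ.mem_Icc b hb).1.trans (hmb'.symm.trans_le (hanti hu.2)),
        (hanti hu.1).trans (hma'.trans_le (hκ.mem_Icc a ha).2)⟩
    · simp only [clamp_of_mem hu]
      have h1 := hS.min_nonpos _ hu
      exact ⟨by nlinarith [hlam.1, hlam.2],
        (mul_nonpos_of_nonneg_of_nonpos hlam.1 h1).trans (hS.max_nonneg _ hu)⟩

/-- Smoothing: a relaxed gain, run along a slightly slower clock `s`, is approximated by an
admissible gain with exponentially small error. -/
theorem IsRelaxedGain.exists_admissible {S : GainSystem} {L : ℝ} (hS : S.RateBounds L)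
    {κ : ℝ → ℝ} (hκ : S.IsRelaxedGain L κ) {K : ℝ} (hK : 0 < K) {W : ℝ → ℝ} (hW : Continuous W)
    (hW0 : ∀ t, 0 ≤ W t) :
    ∃ γ s σ : ℝ → ℝ, S.IsAdmissibleGain γ ∧ Continuous γ ∧ (∀ t, γ t ∈ Icc (0 : ℝ) 1) ∧
      Continuous σ ∧ (∀ t, σ t ∈ Icc (0 : ℝ) 1) ∧
      (∀ t, 0 ≤ t → ∫ r in (0 : ℝ)..t, W r * σ r ≤ 1) ∧
      s 0 = 0 ∧ (∀ t, HasDerivAt s (1 - σ t) t) ∧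
      ∀ t, 0 ≤ t → |γ t - κ (s t)| ≤ 4 * L / K * Real.exp (-(K * t)) := by
  have hL := hS.nonneg
  let e : ℝ → ℝ := fun t => Real.exp (K * t)
  have hec : Continuous e := by fun_prop
  have hemono : StrictMono e := fun x y hxy =>
    Real.exp_lt_exp.2 (mul_lt_mul_of_pos_left hxy hK)
  -- The junction times `log n / K`; cells between consecutive ones have length of order `exp (-K
  -- t)`.
  let G : Set ℝ := e ⁻¹' range ((↑) : ℤ → ℝ)
  have hG : IsClosed G := Int.isClosedEmbedding_coe_real.isClosed_range.preimage hec
  have hGc : G.Countable := (countable_range _).preimage_of_injOn hemono.injective.injOn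
  obtain ⟨σ, hσ, hσ01, hσG, hσW⟩ := exists_continuous_eq_one_integral_le hG hGc hW hW0
  have hσ' : Continuous fun t => 1 - σ t := by fun_prop
  let s : ℝ → ℝ := fun t => ∫ r in (0 : ℝ)..t, (1 - σ r)
  have hs : ∀ t, HasDerivAt s (1 - σ t) t := fun t =>
    intervalIntegral.integral_hasDerivAt_right (hσ'.intervalIntegrable _ _)
      (hσ'.stronglyMeasurableAtFilter _ _) hσ'.continuousAt
  have hs0 : s 0 = 0 := by simp [s]
  have hsmono : Monotone s := monotone_of_deriv_nonneg (fun t => (hs t).differentiableAt)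
    fun t => by rw [(hs t).deriv]; linarith [(hσ01 t).2]
  have hsc : Continuous s := continuous_iff_continuousAt.2 fun t => (hs t).continuousAt
  have hslip : ∀ x y, x ≤ y → s y - s x ≤ y - x := by
    intro x y hxy
    have h1 : Monotone fun t => t - s t := monotone_of_deriv_nonneg
      (fun t => ((hasDerivAt_id t).sub (hs t)).differentiableAt)
      fun t => by
        have := ((hasDerivAt_id t).sub (hs t)).deriv
        change 0 ≤ deriv (id - s) t
        rw [this]; linarith [(hσ01 t).1]
    have := h1 hxy
    simp only at this
    linarith
  -- Since `Real.log 0 = 0`, both `τ 0` and `τ 1` are zero: cell `0` consists of the negative times,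
  -- where a constant piece is used.
  let τ : ℕ → ℝ := fun n => Real.log n / K
  have hτ : ∀ n : ℕ, 1 ≤ n → e (τ n) = n := by
    intro n hn
    simp only [e, τ]
    rw [mul_div_cancel₀ _ hK.ne', Real.exp_log (by exact_mod_cast hn)]
  have hτ0 : ∀ n, 0 ≤ τ n := fun n => div_nonneg (Real.log_natCast_nonneg n) hK.le
  have hτmono : ∀ n, τ n ≤ τ (n + 1) := by
    intro n
    rcases Nat.eq_zero_or_pos n with rfl | hn
    · simp [τ]
    · exact div_le_div_of_nonneg_right (Real.log_le_log (by exact_mod_cast hn)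
        (by push_cast; linarith)) hK.le
  have hsτ0 : ∀ n, 0 ≤ s (τ n) := fun n => hs0 ▸ hsmono (hτ0 n)
  have hpiece : ∀ n : ℕ, ∃ m m' : ℝ → ℝ, Continuous m' ∧ (∀ u, HasDerivAt m (m' u) u) ∧
      m (s (τ n)) = κ (s (τ n)) ∧ m (s (τ (n + 1))) = κ (s (τ (n + 1))) ∧ (∀ u, |m' u| ≤ L) ∧
      (∀ t, ⌊e t⌋₊ = n → m (s t) ∈ Icc (0 : ℝ) 1) ∧
      ∀ u, m u ∈ Icc (0 : ℝ) 1 → S.δmin (m u) ≤ m' u ∧ m' u ≤ S.δmax (m u) := by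
    intro n
    rcases Nat.eq_zero_or_pos n with rfl | hn
    · refine ⟨fun _ => κ 0, fun _ => 0, continuous_const, fun u => hasDerivAt_const _ _,
        by simp [τ, hs0], by simp [τ, hs0], fun _ => by simpa using hL,
        fun _ _ => hκ.mem_Icc 0 le_rfl, fun _ h => ?_⟩
      exact ⟨hS.min_nonpos _ h, hS.max_nonneg _ h⟩
    · obtain ⟨m, m', h1, h2, h3, h4, h5, h6, h7⟩ :=
        hκ.exists_piece hS (hsτ0 n) (hsmono (hτmono n))
      refine ⟨m, m', h1, h2, h3, h4, h5, fun t ht => h6 _ ⟨hsmono ?_, hsmono ?_⟩, h7⟩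
      · rw [← hemono.le_iff_le, hτ n hn, ← ht]
        exact Nat.floor_le (Real.exp_pos _).le
      · rw [← hemono.le_iff_le, hτ (n + 1) (by omega), ← ht]
        push_cast
        exact (Nat.lt_floor_add_one _).le
  choose m m' hm'c hm hml hmr hmL hm01 hmδ using hpiece
  have hmlip : ∀ n u v, |m n v - m n u| ≤ L * |v - u| := fun n u v =>
    convex_univ.norm_image_sub_le_of_norm_hasDerivWithin_le
      (fun x _ => (hm n x).hasDerivWithinAt) (fun x _ => hmL n x) (mem_univ u) (mem_univ v)
  let γ : ℝ → ℝ := fun t => m ⌊e t⌋₊ (s t)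
  let d : ℝ → ℝ := fun t => m' ⌊e t⌋₊ (s t) * (1 - σ t)
  have hγ01 : ∀ t, γ t ∈ Icc (0 : ℝ) 1 := fun t => hm01 _ t rfl
  have hdσ : ∀ t, |d t| ≤ L * (1 - σ t) := fun t => by
    have h1 : 0 ≤ 1 - σ t := by linarith [(hσ01 t).2]
    rw [abs_mul, abs_of_nonneg h1]
    exact mul_le_mul_of_nonneg_right (hmL _ _) h1
  have hlocal : ∀ t, HasDerivAt γ (d t) t ∧ ContinuousAt d t := by
    intro t
    -- At a junction `s' = 0`, and both adjacent pieces are `L`-Lipschitz in `s`; so `γ` moves by `o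
    -- (x - t)` and the one-sided derivatives agree, both being zero. Off the junctions the piece is
    -- locally fixed.
    by_cases ht : t ∈ G
    · have hσt := hσG t ht
      have hdt : d t = 0 := by simp [d, hσt]
      obtain ⟨z, hz⟩ := ht
      have hz1 : 0 < z := by
        have : (0 : ℝ) < z := by rw [hz]; exact Real.exp_pos _
        exact_mod_cast this
      obtain ⟨n, rfl⟩ : ∃ n : ℕ, z = (n + 1 : ℕ) := ⟨(z - 1).toNat, by omega⟩
      have hn : e t = (n + 1 : ℕ) := by rw [← hz]; simp
      have htτ : t = τ (n + 1) := hemono.injective (by rw [hn, hτ _ (by omega)])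
      have hγt : γ t = κ (s t) := by
        simp only [γ]
        rw [hn, Nat.floor_natCast]
        conv_lhs => rw [htτ]
        rw [hml, ← htτ]
      have hb : ∀ᶠ x in 𝓝 t, |γ x - γ t| ≤ L * |s x - s t| := by
        have hlt : (n : ℝ) < e t := by rw [hn]; push_cast; linarith
        have hlt' : e t < (n : ℝ) + 2 := by rw [hn]; push_cast; linarith
        filter_upwards [hec.continuousAt.eventually_const_lt hlt,
          hec.continuousAt.eventually_lt_const hlt'] with x hx1 hx2
        rcases lt_or_ge (e x) (n + 1) with h | h
        · have hf : ⌊e x⌋₊ = n := (Nat.floor_eq_iff (Real.exp_pos _).le).2 ⟨hx1.le, h⟩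
          have : γ t = m n (s t) := by rw [hγt, htτ, hmr]
          rw [this]
          simp only [γ]
          rw [hf]
          exact hmlip _ _ _
        · have hf : ⌊e x⌋₊ = n + 1 := (Nat.floor_eq_iff (Real.exp_pos _).le).2
            ⟨by push_cast; exact h, by push_cast; linarith⟩
          have : γ t = m (n + 1) (s t) := by rw [hγt, htτ, hml]
          rw [this]
          simp only [γ]
          rw [hf]
          exact hmlip _ _ _
      constructor
      · rw [hdt, hasDerivAt_iff_isLittleO]
        have h1 := hs t
        rw [hσt, sub_self, hasDerivAt_iff_isLittleO] at h1
        simp only [smul_zero, sub_zero] at h1 ⊢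
        refine Asymptotics.IsBigO.trans_isLittleO (Asymptotics.IsBigO.of_bound L ?_) h1
        simpa only [Real.norm_eq_abs] using hb
      · rw [ContinuousAt, hdt]
        refine squeeze_zero_norm (a := fun x => L * (1 - σ x)) hdσ ?_
        have h1 : Continuous fun x => L * (1 - σ x) := by fun_prop
        have h2 := h1.tendsto t
        simpa only [hσt, sub_self, mul_zero] using h2
    · have hfl : ∀ᶠ x in 𝓝 t, ⌊e x⌋₊ = ⌊e t⌋₊ := by
        have h1 : (⌊e t⌋₊ : ℝ) < e t := lt_of_le_of_ne (Nat.floor_le (Real.exp_pos _).le)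
          fun h => ht ⟨(⌊e t⌋₊ : ℤ), by simpa using h⟩
        filter_upwards [hec.continuousAt.eventually_const_lt h1,
          hec.continuousAt.eventually_lt_const (Nat.lt_floor_add_one (e t))] with x hx1 hx2
        exact (Nat.floor_eq_iff (Real.exp_pos _).le).2 ⟨hx1.le, hx2⟩
      constructor
      · refine ((hm ⌊e t⌋₊ (s t)).comp t (hs t)).congr_of_eventuallyEq ?_
        filter_upwards [hfl] with x hx
        simp only [γ, hx, Function.comp]
      · have h1 : Continuous fun x => m' ⌊e t⌋₊ (s x) * (1 - σ x) :=
          ((hm'c _).comp hsc).mul hσ'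
        refine h1.continuousAt.congr ?_
        filter_upwards [hfl] with x hx
        simp only [d, hx]
  have hderiv : deriv γ = d := funext fun t => (hlocal t).1.deriv
  have hγ1 : ContDiff ℝ 1 γ := by
    rw [contDiff_one_iff_deriv, hderiv]
    exact ⟨fun t => (hlocal t).1.differentiableAt,
      continuous_iff_continuousAt.2 fun t => (hlocal t).2⟩
  have hdw : ∀ t, 0 ≤ t → derivWithin γ (Ici 0) t = d t := fun t ht =>
    (hlocal t).1.hasDerivWithinAt.derivWithin (uniqueDiffOn_Ici 0 t ht)
  refine ⟨γ, s, σ, ⟨hγ1.contDiffOn, fun t _ => hγ01 t, fun t ht => ?_, fun t ht => ?_⟩,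
    hγ1.continuous, hγ01, hσ, hσ01, hσW, hs0, hs, fun t ht => ?_⟩
  -- Multiplying an admissible rate by `1 - σ ∈ [0, 1]` keeps it admissible, because `δmin ≤ 0 ≤
  -- δmax`.
  · rw [hdw t ht]
    have h1 := (hmδ ⌊e t⌋₊ (s t) (hγ01 t)).1
    have h2 : S.δmin (γ t) ≤ 0 := hS.min_nonpos _ (hγ01 t)
    change S.δmin (γ t) ≤ m' ⌊e t⌋₊ (s t) * (1 - σ t)
    change S.δmin (γ t) ≤ m' ⌊e t⌋₊ (s t) at h1
    nlinarith [(hσ01 t).1, (hσ01 t).2]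
  · rw [hdw t ht]
    have h1 := (hmδ ⌊e t⌋₊ (s t) (hγ01 t)).2
    have h2 : 0 ≤ S.δmax (γ t) := hS.max_nonneg _ (hγ01 t)
    change m' ⌊e t⌋₊ (s t) * (1 - σ t) ≤ S.δmax (γ t)
    change m' ⌊e t⌋₊ (s t) ≤ S.δmax (γ t) at h1
    nlinarith [(hσ01 t).1, (hσ01 t).2]
  · obtain ⟨n, hn⟩ : ∃ n : ℕ, ⌊e t⌋₊ = n := ⟨_, rfl⟩
    have he1 : 1 ≤ e t := Real.one_le_exp (by positivity)
    have hn1 : 1 ≤ n := by rw [← hn]; exact (Nat.one_le_floor_iff _).2 he1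
    have hn1' : (1 : ℝ) ≤ n := by exact_mod_cast hn1
    have hle : (n : ℝ) ≤ e t := by rw [← hn]; exact Nat.floor_le (Real.exp_pos _).le
    have hlt : e t < n + 1 := by rw [← hn]; exact Nat.lt_floor_add_one _
    have hτt : τ n ≤ t := by rwa [← hemono.le_iff_le, hτ n hn1]
    -- From `n K (t - τ n) ≤ e t - n ≤ 1` and `e t ≤ 2 n`. The constant `4 L / K` arises because `γ`
    -- and `κ ∘ s` each move by at most `L (t - τ n)` from their common value at `τ n`.
    have hgap : t - τ n ≤ 2 / K * Real.exp (-(K * t)) := by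
      have h1 : e t = n * Real.exp (K * (t - τ n)) := by
        rw [← hτ n hn1, ← Real.exp_add]
        simp only [e]
        ring_nf
      have h2 := Real.add_one_le_exp (K * (t - τ n))
      have h3 : (n : ℝ) * (K * (t - τ n)) ≤ 1 := by nlinarith
      have h4 : Real.exp (-(K * t)) * e t = 1 := by
        simp only [e]; rw [← Real.exp_add]; simp
      have h5 : 1 ≤ 2 * n * Real.exp (-(K * t)) := by
        have := Real.exp_pos (-(K * t))
        nlinarith
      have h6 : K * (t - τ n) ≤ 2 * Real.exp (-(K * t)) := by
        have h7 : (n : ℝ) * (K * (t - τ n)) ≤ n * (2 * Real.exp (-(K * t))) := by linarith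
        exact le_of_mul_le_mul_left h7 (by linarith)
      rw [div_mul_eq_mul_div, le_div_iff₀ hK]
      linarith
    have h1 : |γ t - κ (s (τ n))| ≤ L * (t - τ n) := by
      simp only [γ]
      rw [hn, ← hml n]
      refine (hmlip _ _ _).trans (mul_le_mul_of_nonneg_left ?_ hL)
      rw [abs_of_nonneg (sub_nonneg.2 (hsmono hτt))]
      exact hslip _ _ hτt
    have h2 : |κ (s (τ n)) - κ (s t)| ≤ L * (t - τ n) := by
      rw [abs_sub_comm]
      refine (hκ.lipschitz _ _ (hsτ0 n) (hs0 ▸ hsmono ht)).trans (mul_le_mul_of_nonneg_left ?_ hL)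
      rw [abs_of_nonneg (sub_nonneg.2 (hsmono hτt))]
      exact hslip _ _ hτt
    have h3 := abs_sub_le (γ t) (κ (s (τ n))) (κ (s t))
    have h4 : L * (t - τ n) ≤ L * (2 / K * Real.exp (-(K * t))) :=
      mul_le_mul_of_nonneg_left hgap hL
    have h5 : 4 * L / K * Real.exp (-(K * t)) = 2 * (L * (2 / K * Real.exp (-(K * t)))) := by ring
    rw [h5]
    linarith

end GainSystem




namespace GainSystem

/-! ### Polar coordinates -/

theorem g_eq (S : GainSystem) (k θ : ℝ) : S.g k θ =
    -Real.sin θ * ((S.A 0 0 + k * (S.b 0 * S.c 0)) * Real.cos θ +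
      (S.A 0 1 + k * (S.b 0 * S.c 1)) * Real.sin θ) +
    Real.cos θ * ((S.A 1 0 + k * (S.b 1 * S.c 0)) * Real.cos θ +
      (S.A 1 1 + k * (S.b 1 * S.c 1)) * Real.sin θ) := by
  simp [g, tangential, radial, loopMatrix, dotProduct, mulVec, Fin.sum_univ_two, vecMulVec_apply]

theorem h_eq (S : GainSystem) (k θ : ℝ) : S.h k θ =
    Real.cos θ * ((S.A 0 0 + k * (S.b 0 * S.c 0)) * Real.cos θ +
      (S.A 0 1 + k * (S.b 0 * S.c 1)) * Real.sin θ) +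
    Real.sin θ * ((S.A 1 0 + k * (S.b 1 * S.c 0)) * Real.cos θ +
      (S.A 1 1 + k * (S.b 1 * S.c 1)) * Real.sin θ) := by
  simp [h, radial, loopMatrix, dotProduct, mulVec, Fin.sum_univ_two, vecMulVec_apply]

theorem continuous_g (S : GainSystem) : Continuous fun p : ℝ × ℝ => S.g p.1 p.2 := by
  simp only [g_eq]; fun_prop

theorem continuous_h (S : GainSystem) : Continuous fun p : ℝ × ℝ => S.h p.1 p.2 := by
  simp only [h_eq]; fun_prop

theorem g_periodic (S : GainSystem) (k : ℝ) : Function.Periodic (S.g k) Real.pi := fun θ => by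
  simp only [g_eq, Real.sin_add_pi, Real.cos_add_pi]; ring

theorem h_periodic (S : GainSystem) (k : ℝ) : Function.Periodic (S.h k) Real.pi := fun θ => by
  simp only [h_eq, Real.sin_add_pi, Real.cos_add_pi]; ring

/-- A continuous function of `(κ, θ)`, periodic in `θ`, takes on `[0, 1] × ℝ` only values taken
on a compact set. -/
theorem exists_mem_compact_eq {F : ℝ → ℝ → ℝ} (hF : ∀ k, Function.Periodic (F k) Real.pi)
    {k : ℝ} (hk : k ∈ Icc (0 : ℝ) 1) (θ : ℝ) :
    ∃ p ∈ Icc (0 : ℝ) 1 ×ˢ Icc (0 : ℝ) Real.pi, F k θ = F p.1 p.2 := by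
  obtain ⟨y, hy, h⟩ := (hF k).exists_mem_Ico₀ Real.pi_pos θ
  exact ⟨(k, y), ⟨hk, hy.1, hy.2.le⟩, h⟩

theorem exists_abs_le_of_periodic {F : ℝ → ℝ → ℝ} (hc : Continuous fun p : ℝ × ℝ => F p.1 p.2)
    (hF : ∀ k, Function.Periodic (F k) Real.pi) :
    ∃ H, ∀ k ∈ Icc (0 : ℝ) 1, ∀ θ, |F k θ| ≤ H := by
  obtain ⟨H, hH⟩ := (isCompact_Icc.prod isCompact_Icc).exists_bound_of_continuousOn
    (hc.continuousOn (s := Icc (0 : ℝ) 1 ×ˢ Icc (0 : ℝ) Real.pi))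
  refine ⟨H, fun k hk θ => ?_⟩
  obtain ⟨p, hp, h⟩ := exists_mem_compact_eq hF hk θ
  rw [h]
  exact hH p hp

theorem exists_pos_le_g (S : GainSystem) (hg : ∀ κ ∈ Icc (0 : ℝ) 1, ∀ θ : ℝ, 0 < S.g κ θ) :
    ∃ g₀ > 0, ∀ k ∈ Icc (0 : ℝ) 1, ∀ θ, g₀ ≤ S.g k θ := by
  obtain ⟨q, hq, hmin⟩ := (isCompact_Icc.prod isCompact_Icc).exists_isMinOn
    (s := Icc (0 : ℝ) 1 ×ˢ Icc (0 : ℝ) Real.pi) ⟨(0, 0), by simp [Real.pi_pos.le]⟩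
    S.continuous_g.continuousOn
  refine ⟨S.g q.1 q.2, hg _ hq.1 _, fun k hk θ => ?_⟩
  obtain ⟨p, hp, h⟩ := exists_mem_compact_eq S.g_periodic hk θ
  rw [h]
  exact hmin hp

/-- The closed loop as a continuous linear map. -/
def loopCLM (S : GainSystem) (k : ℝ) :
    EuclideanSpace ℝ (Fin 2) →L[ℝ] EuclideanSpace ℝ (Fin 2) :=
  toEuclideanCLM (𝕜 := ℝ) S.A + k • toEuclideanCLM (𝕜 := ℝ) (vecMulVec S.b S.c)

theorem closedLoop_apply (S : GainSystem) (k : ℝ) (x : EuclideanSpace ℝ (Fin 2)) (i : Fin 2) :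
    S.closedLoop k x i =
      S.A i 0 * x 0 + S.A i 1 * x 1 + k * (S.c 0 * x 0 + S.c 1 * x 1) * S.b i := by
  change (S.A *ᵥ x.ofLp) i + (k * (S.c ⬝ᵥ x.ofLp)) * S.b i = _
  simp only [mulVec, dotProduct, Fin.sum_univ_two]

theorem loopCLM_apply (S : GainSystem) (k : ℝ) (x : EuclideanSpace ℝ (Fin 2)) :
    S.loopCLM k x = S.closedLoop k x := by
  ext i
  rw [closedLoop_apply]
  simp [loopCLM, mulVec, dotProduct, Fin.sum_univ_two, vecMulVec_apply, ofLp_toEuclideanCLM]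
  ring

/-- The point with polar coordinates `(e ^ ℓ, θ)`. -/
def polar (ℓ θ : ℝ) : EuclideanSpace ℝ (Fin 2) :=
  (Real.exp ℓ * Real.cos θ) • EuclideanSpace.single 0 1 +
    (Real.exp ℓ * Real.sin θ) • EuclideanSpace.single 1 1

theorem norm_polar (ℓ θ : ℝ) : ‖polar ℓ θ‖ = Real.exp ℓ := by
  have h : ‖polar ℓ θ‖ ^ 2 = Real.exp ℓ ^ 2 := by
    rw [EuclideanSpace.real_norm_sq_eq, Fin.sum_univ_two]
    simp only [polar, PiLp.add_apply, PiLp.smul_apply, PiLp.single_apply, smul_eq_mul]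
    simp
    have := Real.sin_sq_add_cos_sq θ
    linear_combination Real.exp ℓ ^ 2 * this
  exact (pow_left_inj₀ (norm_nonneg _) (Real.exp_pos _).le two_ne_zero).1 h

theorem hasDerivWithinAt_polar (S : GainSystem) {κ θ ℓ : ℝ → ℝ} {s : Set ℝ} {t : ℝ}
    (hθ : HasDerivWithinAt θ (S.g (κ t) (θ t)) s t)
    (hℓ : HasDerivWithinAt ℓ (S.h (κ t) (θ t)) s t) :
    HasDerivWithinAt (fun t => polar (ℓ t) (θ t)) (S.closedLoop (κ t) (polar (ℓ t) (θ t))) s t := by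
  have h1 := ((hℓ.exp.mul hθ.cos).smul_const (EuclideanSpace.single (0 : Fin 2) (1 : ℝ))).add
    ((hℓ.exp.mul hθ.sin).smul_const (EuclideanSpace.single (1 : Fin 2) (1 : ℝ)))
  refine h1.congr_deriv ?_
  have hp := Real.sin_sq_add_cos_sq (θ t)
  ext i
  rw [closedLoop_apply]
  fin_cases i
  · simp [polar, g_eq, h_eq]
    linear_combination Real.exp (ℓ t) * ((S.A 0 0 + κ t * (S.b 0 * S.c 0)) * Real.cos (θ t) +
      (S.A 0 1 + κ t * (S.b 0 * S.c 1)) * Real.sin (θ t)) * hp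
  · simp [polar, g_eq, h_eq]
    linear_combination Real.exp (ℓ t) * ((S.A 1 0 + κ t * (S.b 1 * S.c 0)) * Real.cos (θ t) +
      (S.A 1 1 + κ t * (S.b 1 * S.c 1)) * Real.sin (θ t)) * hp

/-! ### From a relaxed trajectory to the failure of absolute stability -/

/-- A relaxed gain with a solution that does not tend to zero destroys absolute stability. -/
theorem IsRelaxedGain.not_isAbsolutelyStable {S : GainSystem} {L : ℝ} (hS : S.RateBounds L)
    {κ θ ℓ : ℝ → ℝ} (hκ : S.IsRelaxedGain L κ)
    (hθ : ∀ t, 0 ≤ t → HasDerivWithinAt θ (S.g (κ t) (θ t)) (Ici 0) t)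
    (hℓ : ∀ t, 0 ≤ t → HasDerivWithinAt ℓ (S.h (κ t) (θ t)) (Ici 0) t)
    (hlarge : ∀ T, ∃ t, T ≤ t ∧ -1 ≤ ℓ t) : ¬ S.IsAbsolutelyStable := by
  intro hstab
  obtain ⟨a, ha⟩ : ∃ a, a = toEuclideanCLM (𝕜 := ℝ) S.A := ⟨_, rfl⟩
  obtain ⟨b, hb⟩ : ∃ b, b = toEuclideanCLM (𝕜 := ℝ) (vecMulVec S.b S.c) := ⟨_, rfl⟩
  have hab : ∀ k, S.loopCLM k = a + k • b := fun k => by rw [ha, hb]; rfl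
  obtain ⟨C, hC⟩ : ∃ C, C = ‖a‖ + ‖b‖ := ⟨_, rfl⟩
  have hC0 : 0 ≤ C := by rw [hC]; positivity
  have hnorm : ∀ k ∈ Icc (0 : ℝ) 1, ‖S.loopCLM k‖ ≤ C := fun k hk => by
    rw [hab, hC]
    refine (norm_add_le _ _).trans (add_le_add le_rfl ?_)
    rw [norm_smul, Real.norm_of_nonneg hk.1]
    exact mul_le_of_le_one_left (norm_nonneg _) hk.2
  -- With `K = 2 C + 1` the gain error, weighted by `e ^ (2 C t)`, is of order `e ^ (-t)` and hence
  -- integrable.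
  obtain ⟨γ, s, σ, hγ, hγc, hγ01, hσc, hσ01, hσW, hs0, hs, herr⟩ :=
    hκ.exists_admissible hS (K := 2 * C + 1) (by linarith)
      (W := fun t => Real.exp (2 * C * t)) (by fun_prop) (fun t => (Real.exp_pos _).le)
  have hsc : Continuous s := continuous_iff_continuousAt.2 fun t => (hs t).continuousAt
  have hsmono : Monotone s := monotone_of_deriv_nonneg (fun t => (hs t).differentiableAt)
    fun t => by rw [(hs t).deriv]; linarith [(hσ01 t).2]
  have hsnn : ∀ t, 0 ≤ t → 0 ≤ s t := fun t ht => hs0 ▸ hsmono ht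
  -- The weight is at least 1, so the clock loses at most one unit of time in total and still runs
  -- through all of `[0, ∞)`.
  have hsge : ∀ t, 0 ≤ t → t - 1 ≤ s t := by
    intro t ht
    have hc1 : Continuous fun r => 1 - σ r := by fun_prop
    have hc2 : Continuous fun r => Real.exp (2 * C * r) * σ r := by fun_prop
    have h1 : ∫ r in (0 : ℝ)..t, (1 - σ r) = s t - s 0 :=
      intervalIntegral.integral_eq_sub_of_hasDerivAt (fun r _ => hs r) (hc1.intervalIntegrable _ _)
    have h2 : ∫ r in (0 : ℝ)..t, (1 - Real.exp (2 * C * r) * σ r) ≤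
        ∫ r in (0 : ℝ)..t, (1 - σ r) := by
      refine intervalIntegral.integral_mono_on ht
        ((continuous_const.sub hc2).intervalIntegrable _ _) (hc1.intervalIntegrable _ _)
        fun r hr => ?_
      have h3 : 1 ≤ Real.exp (2 * C * r) := Real.one_le_exp (mul_nonneg (by positivity) hr.1)
      nlinarith [(hσ01 r).1]
    rw [intervalIntegral.integral_sub (by simp) (hc2.intervalIntegrable _ _)] at h2
    have h3 := hσW t ht
    simp only [intervalIntegral.integral_const, smul_eq_mul, mul_one, sub_zero] at h2
    rw [hs0] at h1
    linarith
  -- Deviation of the time-changed relaxed system from the system with gain `γ`: the first term pays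
  -- for the slowed clock, the second for `γ - κ ∘ s`.
  let w : ℝ → ℝ := fun t =>
    C * σ t + ‖b‖ * (4 * L / (2 * C + 1) * Real.exp (-((2 * C + 1) * t)))
  have hL := hS.nonneg
  have hX0 : Tendsto (fun t => polar (ℓ (s t)) (θ (s t))) atTop (𝓝 0) := by
    refine tendsto_zero_of_linear_perturbation (M := fun t => S.loopCLM (γ t))
      (N := fun t => (1 - σ t) • S.loopCLM (κ (s t))) (C := C) (w := w)
      (R := C + ‖b‖ * (4 * L / (2 * C + 1))) ?_ (fun t => hnorm _ (hγ01 t)) (fun t ht => ?_)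
      (by fun_prop) (fun t ht => ?_) (fun t ht => ?_) (fun x hx => ?_) (fun t ht => ?_)
    · simp only [hab]; fun_prop
    · rw [norm_smul, Real.norm_of_nonneg (by linarith [(hσ01 t).2])]
      refine (mul_le_of_le_one_left (norm_nonneg _) (by linarith [(hσ01 t).1])).trans ?_
      exact hnorm _ (hκ.mem_Icc _ (hsnn t ht))
    · have e : (1 - σ t) • S.loopCLM (κ (s t)) - S.loopCLM (γ t) =
          (-σ t) • S.loopCLM (κ (s t)) + (κ (s t) - γ t) • b := by
        simp only [hab]; module
      rw [e]
      refine (norm_add_le _ _).trans (add_le_add ?_ ?_)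
      · rw [norm_smul, norm_neg, Real.norm_of_nonneg (hσ01 t).1, mul_comm]
        exact mul_le_mul_of_nonneg_right (hnorm _ (hκ.mem_Icc _ (hsnn t ht))) (hσ01 t).1
      · rw [norm_smul, mul_comm, Real.norm_eq_abs, abs_sub_comm]
        exact mul_le_mul_of_nonneg_left (herr t ht) (norm_nonneg _)
    · have e : ∀ r, Real.exp (2 * C * r) * w r = C * (Real.exp (2 * C * r) * σ r) +
          ‖b‖ * (4 * L / (2 * C + 1)) * Real.exp (-r) := by
        intro r
        have : Real.exp (-r) = Real.exp (2 * C * r) * Real.exp (-((2 * C + 1) * r)) := by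
          rw [← Real.exp_add]; ring_nf
        rw [this]
        simp only [w]
        ring
      simp only [e]
      rw [intervalIntegral.integral_add
        (Continuous.intervalIntegrable (by fun_prop) _ _)
        (Continuous.intervalIntegrable (by fun_prop) _ _),
        intervalIntegral.integral_const_mul, intervalIntegral.integral_const_mul]
      have h1 : ∫ r in (0 : ℝ)..t, Real.exp (-r) = 1 - Real.exp (-t) := by
        simp [integral_exp]
      refine add_le_add (mul_le_of_le_one_right hC0 (hσW t ht)) (mul_le_of_le_one_right ?_ ?_)
      · positivity
      · rw [h1]; linarith [Real.exp_pos (-t)]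
    · refine (hstab γ hγ 0 le_rfl).2 x fun t ht => ?_
      rw [← loopCLM_apply]
      exact hx t ht
    · have h1 := (S.hasDerivWithinAt_polar (hθ _ (hsnn t ht)) (hℓ _ (hsnn t ht))).scomp t
        ((hs t).hasDerivWithinAt (s := Ici 0)) (fun r hr => hsnn r hr)
      rw [← loopCLM_apply] at h1
      exact h1
  have hnorm0 : Tendsto (fun t => Real.exp (ℓ (s t))) atTop (𝓝 0) := by
    have := hX0.norm
    simpa only [norm_polar, norm_zero] using this
  obtain ⟨T, hT⟩ := eventually_atTop.1 (hnorm0.eventually_lt_const (Real.exp_pos (-1)))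
  obtain ⟨t, ht, hℓt⟩ := hlarge (s (max T 0))
  have h0 : 0 ≤ t := (hsnn _ (le_max_right _ _)).trans ht
  obtain ⟨r, hr, hrt⟩ := intermediate_value_Icc (f := s) (a := max T 0) (b := max (max T 0) (t + 1))
    (le_max_left _ _) hsc.continuousOn (show t ∈ _ from ⟨ht, by
      have h1 := hsge (max (max T 0) (t + 1)) ((by linarith : 0 ≤ t + 1).trans (le_max_right _ _))
      linarith [le_max_right (max T 0) (t + 1)]⟩)
  have h2 := hT r ((le_max_left _ _).trans hr.1)
  rw [hrt, Real.exp_lt_exp] at h2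
  linarith

end GainSystem




namespace GainSystem

/-! ### Discrete trajectories -/

/-- A discrete trajectory of the polar dynamics with step `τ`: `κ`, `θ`, `ℓ` are the gain, the
angle and the logarithm of the radius, the rates are evaluated at the nearby points `(k, φ)`.
The radius is at least `e⁻¹` whenever the angle is in some `[j P, j P + α]`. -/
structure IsDiscreteTrajectory (S : GainSystem) (P α ε τ : ℝ) (M : ℕ) (κ θ ℓ k φ : ℕ → ℝ) :
    Prop where
  mem : ∀ i ≤ M, κ i ∈ Icc (0 : ℝ) 1
  mem' : ∀ i < M, k i ∈ Icc (0 : ℝ) 1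
  close_gain : ∀ i < M, |k i - κ (i + 1)| ≤ ε
  close_angle : ∀ i < M, |φ i - θ (i + 1)| ≤ ε
  lower : ∀ i < M, τ * S.δmin (k i) ≤ κ (i + 1) - κ i
  upper : ∀ i < M, κ (i + 1) - κ i ≤ τ * S.δmax (k i)
  angle : ∀ i < M, θ (i + 1) - θ i = τ * S.g (k i) (φ i)
  log : ∀ i < M, ℓ (i + 1) - ℓ i = τ * S.h (k i) (φ i)
  angle_zero : |θ 0| ≤ 1
  log_zero : ℓ 0 = 0
  large : ∀ i ≤ M, ∀ j : ℕ, j * P ≤ θ i → θ i ≤ j * P + α → -1 ≤ ℓ i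

theorem coe_clamp (k : ℝ) : clamp k = max 0 (min 1 k) := rfl

/-- Clamping only shortens the step from a point of `[0, 1]`, and the interval of allowed steps
contains 0. -/
theorem sub_clamp_sub_mem {c y A B : ℝ} (hc : c ∈ Icc (0 : ℝ) 1) (hA : A ≤ 0) (hB : 0 ≤ B)
    (hAy : A ≤ y) (hyB : y ≤ B) : c - clamp (c - y) ∈ Icc A B := by
  obtain ⟨h0, h1⟩ := hc
  rw [coe_clamp]
  constructor
  · have : max 0 (min 1 (c - y)) ≤ c - A := max_le (by linarith) ((min_le_right _ _).trans
      (by linarith))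
    linarith
  · have : c - B ≤ max 0 (min 1 (c - y)) := by
      rcases le_total 1 (c - y) with h | h
      · rw [min_eq_left h]; exact le_trans (by linarith) (le_max_right _ _)
      · rw [min_eq_right h]; exact le_trans (by linarith) (le_max_right _ _)
    linarith

theorem sq_sub_clamp_le {c z : ℝ} (hc : c ∈ Icc (0 : ℝ) 1) : (c - clamp z) ^ 2 ≤ (c - z) ^ 2 := by
  obtain ⟨h0, h1⟩ := hc
  rw [coe_clamp]
  rcases le_total 1 z with h | h
  · rw [min_eq_left h, max_eq_right zero_le_one]; nlinarith
  · rw [min_eq_right h]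
    rcases le_total 0 z with h' | h'
    · rw [max_eq_right h']
    · rw [max_eq_left h']; nlinarith

/-- A discrete backward Gronwall inequality. -/
theorem le_exp_mul_of_backward_step {V r : ℕ → ℝ} {M : ℕ} {τ q H T : ℝ} (hτ : 0 ≤ τ) (hq : 0 ≤ q)
    (hH : 0 ≤ H) (hMT : M * τ ≤ T) (hr : ∀ b < M, |r b| ≤ H)
    (hstep : ∀ b < M, V b * Real.exp (-(τ * r b)) ≤ V (b + 1) + τ * q) {b : ℕ} (hb : b ≤ M) :
    V b ≤ Real.exp (∑ c ∈ Finset.range M, τ * r c - ∑ c ∈ Finset.range b, τ * r c) * V M +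
      T * q * Real.exp (2 * (H * T)) := by
  have hT : 0 ≤ T := le_trans (by positivity) hMT
  -- `exp (Λ b)` is the integrating factor: `exp (Λ b) * V b` exceeds its successor by at most the
  -- weighted error `τ q exp (H T)`, and these errors add up downwards from `M`.
  obtain ⟨Λ, hΛ⟩ : ∃ Λ : ℕ → ℝ, Λ = fun b => ∑ c ∈ Finset.range b, τ * r c := ⟨_, rfl⟩
  have hΛs : ∀ b, Λ (b + 1) = Λ b + τ * r b := fun b => by rw [hΛ]; exact Finset.sum_range_succ _ _
  have hΛb : ∀ b ≤ M, |Λ b| ≤ H * T := by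
    intro b hb
    have h1 : |Λ b| ≤ ∑ c ∈ Finset.range b, τ * H := by
      rw [hΛ]
      refine (Finset.abs_sum_le_sum_abs _ _).trans (Finset.sum_le_sum fun c hc => ?_)
      rw [abs_mul, abs_of_nonneg hτ]
      exact mul_le_mul_of_nonneg_left (hr c ((Finset.mem_range.1 hc).trans_le hb)) hτ
    refine h1.trans ?_
    rw [Finset.sum_const, Finset.card_range, nsmul_eq_mul, ← mul_assoc, mul_comm]
    refine mul_le_mul_of_nonneg_left (le_trans ?_ hMT) hH
    exact mul_le_mul_of_nonneg_right (by exact_mod_cast hb) hτ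
  have key : ∀ m ≤ M, Real.exp (Λ (M - m)) * V (M - m) ≤
      Real.exp (Λ M) * V M + m * (τ * q * Real.exp (H * T)) := by
    intro m
    induction m with
    | zero => intro _; simp
    | succ m ih =>
      intro hm
      obtain ⟨b, hb⟩ : ∃ b, b = M - (m + 1) := ⟨_, rfl⟩
      have hb1 : M - m = b + 1 := by omega
      have h1 := ih (by omega)
      rw [hb1] at h1
      rw [← hb]
      have h2 := mul_le_mul_of_nonneg_left (hstep b (by omega)) (Real.exp_pos (Λ (b + 1))).le
      have h3 : Real.exp (Λ (b + 1)) * (V b * Real.exp (-(τ * r b))) = Real.exp (Λ b) * V b := by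
        rw [hΛs, Real.exp_add, Real.exp_neg]
        field_simp
      rw [h3, mul_add] at h2
      have h4 : Real.exp (Λ (b + 1)) * (τ * q) ≤ τ * q * Real.exp (H * T) := by
        rw [mul_comm]
        exact mul_le_mul_of_nonneg_left
          (Real.exp_le_exp.2 ((le_abs_self _).trans (hΛb _ (by omega)))) (by positivity)
      push_cast
      linarith
  have h1 := key (M - b) (by omega)
  rw [Nat.sub_sub_self hb] at h1
  have h2 := mul_le_mul_of_nonneg_left h1 (Real.exp_pos (-Λ b)).le
  have h3 : Real.exp (-Λ b) * (Real.exp (Λ b) * V b) = V b := by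
    rw [← mul_assoc, ← Real.exp_add]; simp
  rw [h3, mul_add, ← mul_assoc, ← Real.exp_add, neg_add_eq_sub] at h2
  rw [hΛ] at h2
  refine h2.trans (add_le_add le_rfl ?_)
  have h4 : Real.exp (-Λ b) ≤ Real.exp (H * T) :=
    Real.exp_le_exp.2 ((neg_le_abs _).trans (hΛb b hb))
  rw [hΛ] at h4
  have h5 : ((M - b : ℕ) : ℝ) * (τ * q * Real.exp (H * T)) ≤ T * q * Real.exp (H * T) := by
    rw [← mul_assoc, ← mul_assoc]
    refine mul_le_mul_of_nonneg_right (mul_le_mul_of_nonneg_right (le_trans ?_ hMT) hq)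
      (Real.exp_pos _).le
    exact mul_le_mul_of_nonneg_right (by exact_mod_cast Nat.sub_le _ _) hτ
  calc _ ≤ Real.exp (H * T) * (T * q * Real.exp (H * T)) :=
        mul_le_mul h4 h5 (by positivity) (Real.exp_pos _).le
    _ = _ := by rw [two_mul, Real.exp_add]; ring

/-! ### Sup-convolution of a subsolution -/

/-- The penalised value of the copy of `ρ` shifted by `j P`. -/
def penalised (ρ : ℝ → ℝ → ℝ) (P a : ℝ) (x : ℝ × ℝ) (j : ℕ) (s : ℝ × ℝ) : ℝ :=
  ρ s.1 s.2 - a * ((s.1 - x.1) ^ 2 + (s.2 + j * P - x.2) ^ 2)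

/-- Compactness in `s` and finiteness in `j`. The maximum has to be attained, since the maximiser is
the touching point for the test function. -/
theorem exists_penalised_max {ρ : ℝ → ℝ → ℝ} (P a : ℝ) {B : ℝ} (hB : 0 ≤ B)
    (hρ : ContinuousOn (fun p : ℝ × ℝ => ρ p.1 p.2) (Icc 0 1 ×ˢ Icc 0 B)) (k : ℕ) (x : ℝ × ℝ) :
    ∃ j ≤ k, ∃ s ∈ Icc (0 : ℝ) 1 ×ˢ Icc 0 B, ∀ j' ≤ k, ∀ s' ∈ Icc (0 : ℝ) 1 ×ˢ Icc 0 B,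
      penalised ρ P a x j' s' ≤ penalised ρ P a x j s := by
  have h1 : ∀ j : ℕ, ∃ s ∈ Icc (0 : ℝ) 1 ×ˢ Icc 0 B, ∀ s' ∈ Icc (0 : ℝ) 1 ×ˢ Icc 0 B,
      penalised ρ P a x j s' ≤ penalised ρ P a x j s := fun j =>
    (isCompact_Icc.prod isCompact_Icc).exists_isMaxOn ⟨(0, 0), by simp [hB]⟩
      (hρ.sub (Continuous.continuousOn (by fun_prop)))
  choose s hs hmax using h1
  obtain ⟨j, hj, hjmax⟩ := Finset.exists_max_image (Finset.range (k + 1))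
    (fun j => penalised ρ P a x j (s j)) ⟨0, by simp⟩
  refine ⟨j, by simpa [Nat.lt_succ_iff] using hj, s j, hs j, fun j' hj' s' hs' => ?_⟩
  exact (hmax j' s' hs').trans (hjmax j' (by simpa [Nat.lt_succ_iff] using hj'))

/-- At a maximum point of the penalised function, the equation for a subsolution yields a rate. -/
theorem IsViscositySubsolution.exists_rate {S : GainSystem} {L : ℝ} (hS : S.RateBounds L)
    (hg : ∀ κ ∈ Icc (0 : ℝ) 1, ∀ θ : ℝ, 0 < S.g κ θ) {ρ : ℝ → ℝ → ℝ}
    (hρ : S.IsViscositySubsolution ρ) {P a B : ℝ} {x : ℝ × ℝ} {j : ℕ} {s : ℝ × ℝ}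
    (hs1 : s.1 ∈ Icc (0 : ℝ) 1) (hs2 : 0 < s.2) (hs3 : s.2 < B)
    (hmax : ∀ s' ∈ Icc (0 : ℝ) 1 ×ˢ Icc 0 B, penalised ρ P a x j s' ≤ penalised ρ P a x j s) :
    ∃ ν, S.δmin s.1 ≤ ν ∧ ν ≤ S.δmax s.1 ∧
      2 * a * ((s.2 + j * P - x.2) * S.g s.1 s.2 + ν * (s.1 - x.1)) ≤
        S.h s.1 s.2 * ρ s.1 s.2 := by
  -- Maximality of `s` says exactly that this paraboloid lies above `ρ` and meets it at `s`.
  let φ : ℝ → ℝ → ℝ := fun k t =>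
    penalised ρ P a x j s + a * ((k - x.1) ^ 2 + (t + j * P - x.2) ^ 2)
  have hφs : φ s.1 s.2 = ρ s.1 s.2 := by simp only [φ, penalised]; ring
  have h1 : S.hjb φ s.1 s.2 ≤ 0 := by
    refine hρ φ (by fun_prop) s.1 s.2 ⟨hs1, hs2⟩ hφs ?_
    have h2 : ∀ᶠ p : ℝ × ℝ in 𝓝 s, p.2 < B :=
      continuous_snd.continuousAt.eventually_lt_const hs3
    filter_upwards [mem_nhdsWithin_of_mem_nhds h2, self_mem_nhdsWithin] with p hp hp'
    have h3 := hmax p ⟨hp'.1, (show (0 : ℝ) < p.2 from hp'.2).le, le_of_lt hp⟩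
    simp only [φ]
    simp only [penalised] at h3 ⊢
    linarith
  have hd1 : deriv (fun t => φ s.1 t) s.2 = 2 * a * (s.2 + j * P - x.2) := by
    have h3 : HasDerivAt (fun t : ℝ => t + j * P - x.2) 1 s.2 :=
      ((hasDerivAt_id s.2).add_const _).sub_const _
    have h4 := ((((h3.pow 2).const_add ((s.1 - x.1) ^ 2)).const_mul a).const_add
      (penalised ρ P a x j s)).deriv
    refine h4.trans ?_
    push_cast; ring
  have hd2 : deriv (fun k => φ k s.2) s.1 = 2 * a * (s.1 - x.1) := by
    have h3 : HasDerivAt (fun k : ℝ => k - x.1) 1 s.1 := (hasDerivAt_id s.1).sub_const _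
    have h4 := ((((h3.pow 2).add_const ((s.2 + j * P - x.2) ^ 2)).const_mul a).const_add
      (penalised ρ P a x j s)).deriv
    refine h4.trans ?_
    push_cast; ring
  have hg0 := hg s.1 hs1 s.2
  have hmin := hS.min_nonpos _ hs1
  have hmax' := hS.max_nonneg _ hs1
  rw [hjb, hd1, hd2, hφs, S.minRate_eq _ hmin hmax', f] at h1
  have key : ∀ ν, 2 * a * (s.2 + j * P - x.2) + 1 / S.g s.1 s.2 * (ν * (2 * a * (s.1 - x.1))) -
      S.h s.1 s.2 / S.g s.1 s.2 * ρ s.1 s.2 ≤ 0 →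
      2 * a * ((s.2 + j * P - x.2) * S.g s.1 s.2 + ν * (s.1 - x.1)) ≤
        S.h s.1 s.2 * ρ s.1 s.2 := by
    intro ν hν
    have h5 := mul_le_mul_of_nonneg_left hν hg0.le
    have h6 : S.g s.1 s.2 * (2 * a * (s.2 + j * P - x.2) +
        1 / S.g s.1 s.2 * (ν * (2 * a * (s.1 - x.1))) - S.h s.1 s.2 / S.g s.1 s.2 * ρ s.1 s.2) =
        2 * a * ((s.2 + j * P - x.2) * S.g s.1 s.2 + ν * (s.1 - x.1)) -
          S.h s.1 s.2 * ρ s.1 s.2 := by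
      field_simp
    rw [h6, mul_zero] at h5
    linarith
  -- The minimising rate is an endpoint. Where `νmin` or `νmax` is set to 0 at the boundary of `[0,
  -- 1]`, it still lies between `δmin` and `δmax`.
  rcases min_choice (S.νmin s.1 * (2 * a * (s.1 - x.1))) (S.νmax s.1 * (2 * a * (s.1 - x.1)))
    with e | e <;> rw [e] at h1
  · refine ⟨S.νmin s.1, ?_, ?_, key _ h1⟩ <;> unfold νmin <;> split_ifs <;> linarith
  · refine ⟨S.νmax s.1, ?_, ?_, key _ h1⟩ <;> unfold νmax <;> split_ifs <;> linarith

/-- The penalised value after one backward Euler step. -/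
theorem le_penalised_step {ρ : ℝ → ℝ → ℝ} {P a τ ν gs hs L G : ℝ} {x s : ℝ × ℝ} {j : ℕ}
    (ha : 0 ≤ a) (hs1 : s.1 ∈ Icc (0 : ℝ) 1) (hν : |ν| ≤ L) (hgs : |gs| ≤ G) (hτ : 0 ≤ τ)
    (hrate : 2 * a * ((s.2 + j * P - x.2) * gs + ν * (s.1 - x.1)) ≤ hs * ρ s.1 s.2) :
    penalised ρ P a x j s - τ * (hs * ρ s.1 s.2) - a * τ ^ 2 * (L ^ 2 + G ^ 2) ≤
      penalised ρ P a (clamp (x.1 - τ * ν), x.2 - τ * gs) j s := by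
  -- Projecting to `[0, 1]` brings the gain no further from `s.1`. Expanding the remaining squares,
  -- the term linear in `τ` is `hrate` and the quadratic one is the stated error.
  have h1 := mul_le_mul_of_nonneg_left (sq_sub_clamp_le (z := x.1 - τ * ν) hs1) ha
  have h2 : ν ^ 2 ≤ L ^ 2 := sq_le_sq' (neg_le_of_abs_le hν) (le_of_abs_le hν)
  have h3 : gs ^ 2 ≤ G ^ 2 := sq_le_sq' (neg_le_of_abs_le hgs) (le_of_abs_le hgs)
  have h4 := mul_le_mul_of_nonneg_left hrate hτ
  have h5 : a * τ ^ 2 * (ν ^ 2 + gs ^ 2) ≤ a * τ ^ 2 * (L ^ 2 + G ^ 2) :=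
    mul_le_mul_of_nonneg_left (add_le_add h2 h3) (by positivity)
  simp only [penalised]
  nlinarith

end GainSystem




/-! ### Backward Euler scheme for the sup-convolution -/

namespace GainSystem

theorem exists_uniform_modulus {ρ : ℝ → ℝ → ℝ} {B η : ℝ}
    (hρ : ContinuousOn (fun p : ℝ × ℝ => ρ p.1 p.2) (Icc 0 1 ×ˢ Icc 0 B)) (hη : 0 < η) :
    ∃ r > 0, ∀ p ∈ Icc (0 : ℝ) 1 ×ˢ Icc 0 B, ∀ q ∈ Icc (0 : ℝ) 1 ×ˢ Icc 0 B,
      |p.1 - q.1| < r → |p.2 - q.2| < r → |ρ p.1 p.2 - ρ q.1 q.2| < η := by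
  obtain ⟨r, hr, h⟩ := Metric.uniformContinuousOn_iff.1
    ((isCompact_Icc.prod isCompact_Icc).uniformContinuousOn_of_continuous hρ) η hη
  exact ⟨r, hr, fun p hp q hq h1 h2 => h p hp q hq (max_lt h1 h2)⟩

/-- If `ρ (κ, P) > 1 = ρ (κ, 0)`, then `ρ (κ, t + P) > ρ (κ, t)` for small `t`, and `ρ (κ, t)` is
close to `1`. -/
theorem exists_shift_gap {ρ : ℝ → ℝ → ℝ} {P : ℝ} (hP : 0 < P)
    (hρ : ContinuousOn (fun p : ℝ × ℝ => ρ p.1 p.2) (Icc 0 1 ×ˢ Ici 0))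
    (hρ0 : ∀ κ ∈ Icc (0 : ℝ) 1, ρ κ 0 = 1) (hρP : ∀ κ ∈ Icc (0 : ℝ) 1, 1 < ρ κ P) :
    ∃ α > 0, α ≤ 1 ∧ ∀ κ ∈ Icc (0 : ℝ) 1, ∀ t ∈ Icc 0 α,
      9 / 10 ≤ ρ κ t ∧ ρ κ t < ρ κ (t + P) := by
  have hc : ContinuousOn (fun κ => ρ κ P) (Icc 0 1) :=
    hρ.comp (f := fun κ => (κ, P)) (by fun_prop) fun κ hκ => ⟨hκ, hP.le⟩
  obtain ⟨κ₀, hκ₀, hmin⟩ := isCompact_Icc.exists_isMinOn ⟨0, by simp⟩ hc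
  have hμ := hρP κ₀ hκ₀
  have hB : ContinuousOn (fun p : ℝ × ℝ => ρ p.1 p.2) (Icc 0 1 ×ˢ Icc 0 (P + 1)) :=
    hρ.mono (prod_mono le_rfl Icc_subset_Ici_self)
  -- Error `1 / 10` gives the lower bound `9 / 10`; half of the smallest gap `ρ κ P - 1` keeps the
  -- values near angle 0 below those near angle `P`.
  obtain ⟨r, hr, h⟩ := exists_uniform_modulus hB
    (η := min (1 / 10) ((ρ κ₀ P - 1) / 2)) (lt_min (by norm_num) (by linarith))
  refine ⟨min 1 (r / 2), lt_min one_pos (half_pos hr), min_le_left _ _, fun κ hκ t ht => ?_⟩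
  have ht1 : t ≤ 1 := ht.2.trans (min_le_left _ _)
  have ht2 : |t| < r := by
    rw [abs_of_nonneg ht.1]
    exact (ht.2.trans (min_le_right _ _)).trans_lt (half_lt_self hr)
  have h1 := h (κ, t) ⟨hκ, ht.1, by linarith⟩ (κ, 0) ⟨hκ, le_rfl, by linarith⟩ (by simpa using hr)
    (by simpa using ht2)
  have h2 := h (κ, t + P) ⟨hκ, by linarith [ht.1], by linarith⟩ (κ, P)
    ⟨hκ, hP.le, by linarith⟩ (by simpa using hr) (by simpa using ht2)
  simp only [hρ0 κ hκ, lt_min_iff, abs_lt] at h1 h2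
  have h3 : ρ κ₀ P ≤ ρ κ P := hmin hκ
  constructor <;> linarith [h1.1.1, h1.2.2, h2.2.1]

set_option maxHeartbeats 2000000 in
/-- A backward Euler scheme along which the sup-convolution `V` of the shifted copies of `ρ`
does not decrease faster than the radius, on the strip `d ≤ x.2 ≤ m P`. -/
theorem exists_sup_convolution {S : GainSystem} {L G H P : ℝ} (hS : S.RateBounds L)
    (hg : ∀ κ ∈ Icc (0 : ℝ) 1, ∀ θ : ℝ, 0 < S.g κ θ)
    (hG : ∀ k ∈ Icc (0 : ℝ) 1, ∀ θ, |S.g k θ| ≤ G) (hH : ∀ k ∈ Icc (0 : ℝ) 1, ∀ θ, |S.h k θ| ≤ H)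
    (hgP : ∀ k θ (j : ℕ), S.g k (θ + j * P) = S.g k θ)
    (hhP : ∀ k θ (j : ℕ), S.h k (θ + j * P) = S.h k θ) (hP : 0 < P)
    {ρ : ℝ → ℝ → ℝ} (hρ : S.IsViscositySolution ρ) {α : ℝ} (hα0 : 0 < α) (hα1 : α ≤ 1)
    (hα : ∀ κ ∈ Icc (0 : ℝ) 1, ∀ t ∈ Icc 0 α, 9 / 10 ≤ ρ κ t ∧ ρ κ t < ρ κ (t + P))
    {ε q : ℝ} (hε : 0 < ε) (hq : 0 < q) {m : ℕ} (hm : 1 ≤ m) :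
    ∃ (d τ : ℝ) (V : ℝ × ℝ → ℝ), 0 < d ∧ d ≤ 1 ∧ 0 < τ ∧ τ ≤ ε ∧
      (∀ x, x.1 ∈ Icc (0 : ℝ) 1 → 0 ≤ x.2 → x.2 < d → V x ≤ 11 / 10) ∧
      (∀ x, x.1 ∈ Icc (0 : ℝ) 1 → x.2 ≤ m * P → ∀ j : ℕ, j * P ≤ x.2 → x.2 ≤ j * P + α →
        9 / 10 ≤ V x) ∧
      ∀ x : ℝ × ℝ, x.1 ∈ Icc (0 : ℝ) 1 → d ≤ x.2 → x.2 ≤ m * P →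
        ∃ (x' : ℝ × ℝ) (k φ : ℝ), x'.1 ∈ Icc (0 : ℝ) 1 ∧ 0 ≤ x'.2 ∧ k ∈ Icc (0 : ℝ) 1 ∧
          |k - x.1| ≤ ε ∧ |φ - x.2| ≤ ε ∧ x.1 - x'.1 ∈ Icc (τ * S.δmin k) (τ * S.δmax k) ∧
          x.2 - x'.2 = τ * S.g k φ ∧ V x * Real.exp (-(τ * S.h k φ)) ≤ V x' + τ * q := by
  have hmP : P ≤ m * P := le_mul_of_one_le_left hP.le (by exact_mod_cast hm)
  have h01 : (0 : ℝ) ∈ Icc (0 : ℝ) 1 := by simp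
  have hH0 : 0 ≤ H := (abs_nonneg _).trans (hH 0 h01 0)
  have hG0 : 0 < G := (hg 0 h01 0).trans_le ((le_abs_self _).trans (hG 0 h01 0))
  -- The extra unit keeps maximisers away from the artificial edge `B` and leaves room for the
  -- competitor shifted by `P`.
  obtain ⟨B, hB⟩ : ∃ B : ℝ, B = m * P + 1 := ⟨_, rfl⟩
  have hc : ContinuousOn (fun p : ℝ × ℝ => ρ p.1 p.2) (Icc 0 1 ×ˢ Icc 0 B) :=
    hρ.continuousOn.mono (prod_mono le_rfl Icc_subset_Ici_self)
  obtain ⟨R, hR⟩ := (isCompact_Icc.prod isCompact_Icc).exists_bound_of_continuousOn hc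
  have hR0 : 0 ≤ R := (norm_nonneg _).trans (hR (0, 0) ⟨h01, le_rfl, by linarith⟩)
  obtain ⟨η, hη⟩ : ∃ η, η = min (1 / 10) (q / (2 * (H + 1))) := ⟨_, rfl⟩
  have hη0 : 0 < η := by rw [hη]; positivity
  have hη1 : η ≤ 1 / 10 := hη ▸ min_le_left _ _
  have hη2 : H * η + η ≤ q / 2 := by
    have : η ≤ q / (2 * (H + 1)) := hη ▸ min_le_right _ _
    rw [le_div_iff₀ (by positivity)] at this
    linarith
  obtain ⟨r, hr, hmod⟩ := exists_uniform_modulus hc hη0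
  obtain ⟨d, hd⟩ : ∃ d, d = min (r / 3) (min (P / 3) (1 / 2)) := ⟨_, rfl⟩
  have hd0 : 0 < d := by rw [hd]; positivity
  have hdr : d ≤ r / 3 := hd ▸ min_le_left _ _
  have hdP : d ≤ P / 3 := hd ▸ (min_le_right _ _).trans (min_le_left _ _)
  have hd1 : d ≤ 1 / 2 := hd ▸ (min_le_right _ _).trans (min_le_right _ _)
  obtain ⟨r₁, hr₁⟩ : ∃ r₁, r₁ = min d (min ε (α / 2)) := ⟨_, rfl⟩
  have hr0 : 0 < r₁ := by rw [hr₁]; positivity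
  have hrd : r₁ ≤ d := hr₁ ▸ min_le_left _ _
  have hrε : r₁ ≤ ε := hr₁ ▸ (min_le_right _ _).trans (min_le_left _ _)
  have hrα : r₁ ≤ α / 2 := hr₁ ▸ (min_le_right _ _).trans (min_le_right _ _)
  -- At distance `r₁` the penalty exceeds the possible gain `2 R` in `ρ`, so maximisers stay within
  -- `r₁` of `x`.
  obtain ⟨a, ha⟩ : ∃ a, a = 2 * R / r₁ ^ 2 + 1 := ⟨_, rfl⟩
  have ha0 : 0 < a := by rw [ha]; positivity
  have har : 2 * R < a * r₁ ^ 2 := by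
    rw [ha, add_mul, div_mul_cancel₀ _ (by positivity)]
    have : 0 < r₁ ^ 2 := by positivity
    linarith
  -- the step size
  obtain ⟨τ, hτ0, hτε, hτG, hτa, hτR, hτH⟩ : ∃ τ > 0, τ ≤ ε ∧ τ * G ≤ d ∧
      a * τ * (L ^ 2 + G ^ 2) ≤ η ∧ R * H ^ 2 * τ ≤ q / 2 ∧ τ * H ≤ 1 := by
    have hlim : ∀ c D : ℝ, 0 < D → ∀ᶠ τ in 𝓝[>] (0 : ℝ), c * τ ≤ D := fun c D hD => by
      have h1 : Tendsto (fun τ : ℝ => c * τ) (𝓝 0) (𝓝 (c * 0)) :=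
        tendsto_id.const_mul c
      rw [mul_zero] at h1
      exact ((h1.mono_left nhdsWithin_le_nhds).eventually_lt_const hD).mono fun _ h => h.le
    obtain ⟨τ, ⟨⟨⟨⟨h1, h2⟩, h3⟩, h4⟩, h5⟩, h6⟩ := (((((hlim 1 ε hε).and (hlim G d hd0)).and
      (hlim (a * (L ^ 2 + G ^ 2)) η hη0)).and (hlim (R * H ^ 2) (q / 2) (half_pos hq))).and
      (hlim H 1 one_pos)).and self_mem_nhdsWithin |>.exists
    exact ⟨τ, h6, by linarith, by linarith, by linarith, h4, by linarith⟩
  have hB0 : 0 ≤ B := by linarith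
  choose J hJ s hs hmax using exists_penalised_max P a hB0 hc m
  obtain ⟨V, hV⟩ : ∃ V : ℝ × ℝ → ℝ, V = fun x => penalised ρ P a x (J x) (s x) := ⟨_, rfl⟩
  have hVx : ∀ x, V x = ρ (s x).1 (s x).2 -
      a * (((s x).1 - x.1) ^ 2 + ((s x).2 + J x * P - x.2) ^ 2) := fun x => by rw [hV]; rfl
  have hVge : ∀ x : ℝ × ℝ, x.1 ∈ Icc (0 : ℝ) 1 → ∀ j : ℕ, j ≤ m → j * P ≤ x.2 → x.2 - j * P ≤ B →
      ρ x.1 (x.2 - j * P) ≤ V x := by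
    intro x hx j hj h1 h2
    have h3 := hmax x j hj (x.1, x.2 - j * P) ⟨hx, sub_nonneg.2 h1, h2⟩
    have h4 : penalised ρ P a x j (x.1, x.2 - j * P) = ρ x.1 (x.2 - j * P) := by
      simp [penalised]
    rw [h4] at h3
    rw [hV]
    exact h3
  have hVle : ∀ x, V x ≤ ρ (s x).1 (s x).2 := fun x => by
    rw [hVx]
    have : 0 ≤ a * (((s x).1 - x.1) ^ 2 + ((s x).2 + J x * P - x.2) ^ 2) := by positivity
    linarith
  have hVabs : ∀ x : ℝ × ℝ, x.1 ∈ Icc (0 : ℝ) 1 → 0 ≤ x.2 → x.2 ≤ m * P → |V x| ≤ R := by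
    intro x hx h1 h2
    have h3 := hVge x hx 0 (Nat.zero_le _) (by simpa using h1) (by simp; linarith)
    simp only [Nat.cast_zero, zero_mul, sub_zero] at h3
    have h4 := hR x ⟨hx, h1, by linarith⟩
    have h5 := hR _ (hs x)
    rw [Real.norm_eq_abs] at h4 h5
    exact abs_le.2 ⟨(neg_le_of_abs_le h4).trans h3, (hVle x).trans (le_of_abs_le h5)⟩
  have hclose : ∀ x : ℝ × ℝ, x.1 ∈ Icc (0 : ℝ) 1 → 0 ≤ x.2 → x.2 ≤ m * P →
      |(s x).1 - x.1| < r₁ ∧ |(s x).2 + J x * P - x.2| < r₁ := by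
    intro x hx h1 h2
    have h3 := (abs_le.1 (hVabs x hx h1 h2)).1
    have h4 := hR _ (hs x)
    rw [Real.norm_eq_abs] at h4
    have h5 := (abs_le.1 h4).2
    rw [hVx] at h3
    have h6 : a * (((s x).1 - x.1) ^ 2 + ((s x).2 + J x * P - x.2) ^ 2) < a * r₁ ^ 2 := by
      linarith
    have h7 := lt_of_mul_lt_mul_left h6 ha0.le
    constructor <;> refine abs_lt_of_sq_lt_sq ?_ hr0.le
    · nlinarith [sq_nonneg ((s x).2 + J x * P - x.2)]
    · nlinarith [sq_nonneg ((s x).1 - x.1)]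
  refine ⟨d, τ, V, hd0, by linarith, hτ0, hτε, ?_, ?_, ?_⟩
  · intro x hx h1 h2
    obtain ⟨-, h3⟩ := hclose x hx h1 (by linarith)
    have h4 := (abs_lt.1 h3).2
    -- A copy with `J x ≥ 1` would need `P < r₁ + d ≤ 2 d`, but `d ≤ P / 3`.
    have h5 : J x = 0 := by
      by_contra h
      have h6 : (1 : ℝ) ≤ J x := by exact_mod_cast Nat.one_le_iff_ne_zero.2 h
      have h7 := (hs x).2.1
      nlinarith
    rw [h5] at h4
    simp only [Nat.cast_zero, zero_mul, add_zero] at h4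
    have h6 := hmod (s x) (hs x) ((s x).1, 0) ⟨(hs x).1, le_rfl, hB0⟩ (by simpa using hr)
      (by
        rw [sub_zero, abs_of_nonneg (hs x).2.1]
        linarith)
    simp only [hρ.boundary _ (hs x).1] at h6
    have h7 := (abs_lt.1 h6).2
    have h8 := hVle x
    linarith
  · intro x hx h1 j h2 h3
    have hj : j ≤ m := by
      have : (j : ℝ) * P ≤ m * P := h2.trans h1
      exact_mod_cast le_of_mul_le_mul_right this hP
    refine (hα x.1 hx (x.2 - j * P) ⟨by linarith, by linarith⟩).1.trans ?_
    exact hVge x hx j hj h2 (by linarith)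
  · intro x hx hdx hxm
    have hx0 : 0 ≤ x.2 := hd0.le.trans hdx
    obtain ⟨hc1, hc2⟩ := hclose x hx hx0 hxm
    obtain ⟨hs1, hs20, hs2B⟩ := hs x
    have hc2' := abs_lt.1 hc2
    -- This is where growth over one period enters. Were the maximiser at angle at most `α` in its
    -- copy, moving it up by `P` in the previous copy would leave the penalty unchanged and increase
    -- `ρ`.
    have hJα : J x ≠ 0 → α < (s x).2 := by
      intro hJ0
      by_contra! hle
      obtain ⟨i, hi⟩ := Nat.exists_eq_succ_of_ne_zero hJ0
      have h1 := hmax x i (by have := hJ x; omega) ((s x).1, (s x).2 + P)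
        ⟨hs1, by linarith, by linarith⟩
      have h2 := (hα _ hs1 _ ⟨hs20, hle⟩).2
      have h3 : penalised ρ P a x i ((s x).1, (s x).2 + P) =
          ρ (s x).1 ((s x).2 + P) -
            a * (((s x).1 - x.1) ^ 2 + ((s x).2 + J x * P - x.2) ^ 2) := by
        rw [hi]; simp only [penalised]; push_cast; ring
      have h4 := hVx x
      rw [hV] at h4
      simp only at h4
      rw [h3, h4] at h1
      linarith
    have hJP : 0 ≤ J x * P := by positivity
    -- In copy 0 the maximiser is within `r₁ ≤ d ≤ x.2` of `x`; in the others it is above `α`. Hence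
    -- the equation applies there.
    have hs2pos : 0 < (s x).2 := by
      by_cases hJ0 : J x = 0
      · rw [hJ0] at hc2'
        simp only [Nat.cast_zero, zero_mul, add_zero] at hc2'
        linarith [hc2'.1]
      · exact hα0.trans (hJα hJ0)
    have hxJ : J x * P ≤ x.2 := by
      by_cases hJ0 : J x = 0
      · rw [hJ0]; simpa using hx0
      · linarith [hJα hJ0, hc2'.2]
    obtain ⟨ν, hν1, hν2, hν⟩ := hρ.subsolution.exists_rate hS hg hs1 hs2pos (B := B)
      (by linarith [hc2'.2]) (hmax x (J x) (hJ x))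
    have hνL : |ν| ≤ L := abs_le.2 ⟨(hS.le_min _ hs1).trans hν1, hν2.trans (hS.max_le _ hs1)⟩
    have hstep := le_penalised_step ha0.le hs1 hνL (hG _ hs1 (s x).2) hτ0.le hν
    obtain ⟨x', hx'⟩ : ∃ x' : ℝ × ℝ,
      x' = (clamp (x.1 - τ * ν), x.2 - τ * S.g (s x).1 (s x).2) := ⟨_, rfl⟩
    rw [← hx'] at hstep
    have hVx' : penalised ρ P a x' (J x) (s x) ≤ V x' := by
      rw [hV]; exact hmax x' _ (hJ x) _ (hs x)
    have hVxp : penalised ρ P a x (J x) (s x) = V x := by rw [hV]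
    have hgs := hg _ hs1 (s x).2
    have hgG := (le_abs_self _).trans (hG _ hs1 (s x).2)
    have hmin := hS.min_nonpos _ hs1
    have hmx := hS.max_nonneg _ hs1
    refine ⟨x', (s x).1, (s x).2 + J x * P, by rw [hx']; exact clamp_mem _, ?_, hs1,
      (hc1.le.trans hrε), hc2.le.trans hrε, ?_, ?_, ?_⟩
    · rw [hx']
      have : τ * S.g (s x).1 (s x).2 ≤ τ * G := mul_le_mul_of_nonneg_left hgG hτ0.le
      simp only
      linarith
    · rw [hx']
      exact sub_clamp_sub_mem hx (mul_nonpos_of_nonneg_of_nonpos hτ0.le hmin)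
        (mul_nonneg hτ0.le hmx) (mul_le_mul_of_nonneg_left hν1 hτ0.le)
        (mul_le_mul_of_nonneg_left hν2 hτ0.le)
    · rw [hgP, hx']; simp
    · rw [hhP]
      obtain ⟨hh, hhdef⟩ : ∃ hh, hh = S.h (s x).1 (s x).2 := ⟨_, rfl⟩
      have hhH : |hh| ≤ H := hhdef ▸ hH _ hs1 _
      rw [← hhdef] at hstep ⊢
      -- Three errors fit into `τ q`: replacing `ρ (s x)` by `V x` and the quadratic penalty term
      -- cost `τ (H η + η)`; linearising the exponential costs `R (τ H) ^ 2`. Each group is at most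
      -- `τ q / 2`.
      obtain ⟨e, he⟩ : ∃ e, e = ρ (s x).1 (s x).2 - V x := ⟨_, rfl⟩
      have he0 : 0 ≤ e := by rw [he]; linarith [hVle x]
      have heη : e ≤ η := by
        have h1 := hmod (s x) (hs x) (x.1, x.2 - J x * P) ⟨hx, by linarith, by linarith⟩
          (by simpa using hc1.trans_le (by linarith)) (by
            have h2 : (s x).2 - (x.2 - J x * P) = (s x).2 + J x * P - x.2 := by ring
            simp only [h2]
            linarith)
        have h2 := hVge x hx (J x) (hJ x) hxJ (by linarith)
        have h3 := (abs_lt.1 h1).2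
        simp only at h3
        rw [he]
        linarith
      have hρe : ρ (s x).1 (s x).2 = V x + e := by rw [he]; ring
      rw [hρe, hVxp] at hstep
      have hτh : |-(τ * hh)| ≤ τ * H := by
        rw [abs_neg, abs_mul, abs_of_pos hτ0]
        exact mul_le_mul_of_nonneg_left hhH hτ0.le
      have hexp := Real.abs_exp_sub_one_sub_id_le (hτh.trans hτH)
      have hsq : (-(τ * hh)) ^ 2 ≤ (τ * H) ^ 2 := sq_le_sq' (neg_le_of_abs_le hτh) (le_of_abs_le hτh)
      have h1 : V x * (Real.exp (-(τ * hh)) - 1 - -(τ * hh)) ≤ R * (τ * H) ^ 2 := by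
        refine (le_abs_self _).trans ?_
        rw [abs_mul]
        exact mul_le_mul (hVabs x hx hx0 hxm) (hexp.trans hsq) (abs_nonneg _) hR0
      have h2 : hh * e ≤ H * η :=
        (mul_le_mul_of_nonneg_right (le_of_abs_le hhH) he0).trans
          (mul_le_mul_of_nonneg_left heη hH0)
      have h3 : a * τ ^ 2 * (L ^ 2 + G ^ 2) ≤ τ * η := by
        have := mul_le_mul_of_nonneg_left hτa hτ0.le
        linarith
      have h4 : R * (τ * H) ^ 2 ≤ τ * (q / 2) := by
        have := mul_le_mul_of_nonneg_left hτR hτ0.le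
        linarith
      have h5 : τ * (hh * e) ≤ τ * (H * η) := mul_le_mul_of_nonneg_left h2 hτ0.le
      have h6 : τ * (H * η + η) ≤ τ * (q / 2) := mul_le_mul_of_nonneg_left hη2 hτ0.le
      linarith

end GainSystem




/-! ### Discrete trajectories of arbitrary length -/

namespace GainSystem

/-- Long discrete trajectories with arbitrarily fine resolution. -/
theorem exists_discreteTrajectory {S : GainSystem} {L G H g₀ P : ℝ} (hS : S.RateBounds L)
    (hg₀ : 0 < g₀) (hg : ∀ κ ∈ Icc (0 : ℝ) 1, ∀ θ : ℝ, g₀ ≤ S.g κ θ)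
    (hG : ∀ k ∈ Icc (0 : ℝ) 1, ∀ θ, |S.g k θ| ≤ G) (hH : ∀ k ∈ Icc (0 : ℝ) 1, ∀ θ, |S.h k θ| ≤ H)
    (hgP : ∀ k θ (j : ℕ), S.g k (θ + j * P) = S.g k θ)
    (hhP : ∀ k θ (j : ℕ), S.h k (θ + j * P) = S.h k θ) (hP : 0 < P)
    {ρ : ℝ → ℝ → ℝ} (hρ : S.IsViscositySolution ρ) {α : ℝ} (hα0 : 0 < α) (hα1 : α ≤ 1)
    (hα : ∀ κ ∈ Icc (0 : ℝ) 1, ∀ t ∈ Icc 0 α, 9 / 10 ≤ ρ κ t ∧ ρ κ t < ρ κ (t + P))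
    {ε : ℝ} (hε : 0 < ε) (n : ℕ) :
    ∃ (τ : ℝ) (M : ℕ) (κ θ ℓ k φ : ℕ → ℝ), 0 < τ ∧ τ ≤ ε ∧ n ≤ M * τ ∧
      S.IsDiscreteTrajectory P α ε τ M κ θ ℓ k φ := by
  have h01 : (0 : ℝ) ∈ Icc (0 : ℝ) 1 := by simp
  have hH0 : 0 ≤ H := (abs_nonneg _).trans (hH 0 h01 0)
  have hG0 : 0 < G := (hg₀.trans_le (hg 0 h01 0)).trans_le ((le_abs_self _).trans (hG 0 h01 0))
  -- Angular speed is at most `G`, so descending from `m P` to below `d ≤ 1` takes at least time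
  -- `n`; it takes at most `T = m P / g₀`, and `q` makes the Gronwall error over that time at most
  -- `1 / 10`.
  obtain ⟨m, hm⟩ := exists_nat_ge (max 1 ((G * n + 1) / P))
  have hm1 : 1 ≤ m := by exact_mod_cast (le_max_left _ _).trans hm
  have hmP : G * n + 1 ≤ m * P := (div_le_iff₀ hP).1 ((le_max_right _ _).trans hm)
  obtain ⟨T, hT⟩ : ∃ T, T = m * P / g₀ := ⟨_, rfl⟩
  have hT0 : 0 ≤ T := by rw [hT]; positivity
  obtain ⟨q, hq⟩ : ∃ q, q = 1 / (10 * (T * Real.exp (2 * (H * T)) + 1)) := ⟨_, rfl⟩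
  have hq0 : 0 < q := by rw [hq]; positivity
  have hTq : T * q * Real.exp (2 * (H * T)) ≤ 1 / 10 := by
    have h1 : T * q * Real.exp (2 * (H * T)) =
        (T * Real.exp (2 * (H * T))) / (10 * (T * Real.exp (2 * (H * T)) + 1)) := by
      rw [hq]; ring
    rw [h1, div_le_div_iff₀ (by positivity) (by norm_num)]
    linarith
  obtain ⟨d, τ, V, hd0, hd1, hτ0, hτε, hVend, hVlarge, hstep⟩ := exists_sup_convolution hS
    (fun κ hκ θ => hg₀.trans_le (hg κ hκ θ)) hG hH hgP hhP hP hρ hα0 hα1 hα hε hq0 hm1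
  choose! F k φ hF1 hF2 hk hk1 hφ hFκ hFθ hFV using hstep
  obtain ⟨X, hX⟩ : ∃ X : ℕ → ℝ × ℝ, X = fun b => F^[b] (0, m * P) := ⟨_, rfl⟩
  have hX0 : X 0 = (0, m * P) := by rw [hX]; rfl
  have hXs : ∀ b, X (b + 1) = F (X b) := fun b => by
    rw [hX]; exact Function.iterate_succ_apply' F b _
  have hinv : ∀ b, (∀ c < b, d ≤ (X c).2) → (X b).1 ∈ Icc (0 : ℝ) 1 ∧ 0 ≤ (X b).2 ∧
      (X b).2 ≤ m * P - b * (τ * g₀) := by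
    intro b
    induction b with
    | zero => intro _; rw [hX0]; simp; positivity
    | succ b ih =>
      intro hb
      obtain ⟨h1, h2, h3⟩ := ih fun c hc => hb c (by omega)
      have h4 := hb b (by omega)
      have h5 : (X b).2 ≤ m * P := h3.trans (sub_le_self _ (by positivity))
      rw [hXs]
      refine ⟨hF1 _ h1 h4 h5, hF2 _ h1 h4 h5, ?_⟩
      have h6 := hFθ _ h1 h4 h5
      have h7 := mul_le_mul_of_nonneg_left (hg _ (hk _ h1 h4 h5) (φ (X b))) hτ0.le
      push_cast
      linarith
  have hex : ∃ b, (X b).2 < d := by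
    by_contra! hcon
    obtain ⟨b, hb⟩ := exists_nat_gt (m * P / (τ * g₀))
    have h1 := (hinv b fun c _ => hcon c).2
    rw [div_lt_iff₀ (by positivity)] at hb
    linarith [h1.1, h1.2, hcon b]
  classical
  -- The descent stops at the first angle below `d`, where `V ≤ 11 / 10`; all earlier points lie in
  -- the strip where a step is available.
  obtain ⟨M, hM⟩ : ∃ M, M = Nat.find hex := ⟨_, rfl⟩
  have hMd : (X M).2 < d := hM ▸ Nat.find_spec hex
  have hlt : ∀ b < M, d ≤ (X b).2 := fun b hb => not_lt.1 (Nat.find_min hex (hM ▸ hb))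
  have hreg : ∀ b ≤ M, (X b).1 ∈ Icc (0 : ℝ) 1 ∧ 0 ≤ (X b).2 ∧ (X b).2 ≤ m * P := by
    intro b hb
    obtain ⟨h1, h2, h3⟩ := hinv b fun c hc => hlt c (by omega)
    exact ⟨h1, h2, h3.trans (sub_le_self _ (by positivity))⟩
  have hMT : M * τ ≤ T := by
    obtain ⟨-, h2, h3⟩ := hinv M hlt
    rw [hT, le_div_iff₀ hg₀]
    linarith
  have hlow : ∀ b ≤ M, m * P - b * (τ * G) ≤ (X b).2 := by
    intro b
    induction b with
    | zero => intro _; rw [hX0]; simp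
    | succ b ih =>
      intro hb
      have h1 := ih (by omega)
      obtain ⟨h2, -, h3⟩ := hreg b (by omega)
      have h4 := hlt b (by omega)
      have h5 := hFθ _ h2 h4 h3
      have h6 := mul_le_mul_of_nonneg_left
        ((le_abs_self _).trans (hG _ (hk _ h2 h4 h3) (φ (X b)))) hτ0.le
      rw [hXs]
      push_cast
      linarith
  obtain ⟨r, hr⟩ : ∃ r : ℕ → ℝ, r = fun b => S.h (k (X b)) (φ (X b)) := ⟨_, rfl⟩
  have hrH : ∀ b < M, |r b| ≤ H := by
    intro b hb
    obtain ⟨h2, -, h3⟩ := hreg b hb.le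
    rw [hr]
    exact hH _ (hk _ h2 (hlt b hb) h3) _
  obtain ⟨Λ, hΛ⟩ : ∃ Λ : ℕ → ℝ, Λ = fun b => ∑ c ∈ Finset.range b, τ * r c := ⟨_, rfl⟩
  have hΛs : ∀ b, Λ (b + 1) = Λ b + τ * r b := fun b => by rw [hΛ]; exact Finset.sum_range_succ _ _
  have hgrow : ∀ b ≤ M, V (X b) ≤ Real.exp (Λ M - Λ b) * V (X M) + 1 / 10 := by
    intro b hb
    have h1 := le_exp_mul_of_backward_step (V := fun b => V (X b)) hτ0.le hq0.le hH0 hMT hrH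
      (fun b hb => by
        obtain ⟨h2, -, h3⟩ := hreg b hb.le
        have := hFV _ h2 (hlt b hb) h3
        rw [← hXs] at this
        rw [hr]
        exact this) hb
    rw [hΛ]
    linarith
  -- The orbit was built backwards in time, so indices are reversed. The step from `i` to `i + 1`
  -- was constructed at the later point, which explains the index `M - i - 1` of the rates.
  refine ⟨τ, M, fun i => (X (M - i)).1, fun i => (X (M - i)).2, fun i => Λ M - Λ (M - i),
    fun i => k (X (M - i - 1)), fun i => φ (X (M - i - 1)), hτ0, hτε, ?_, ?_⟩
  · have h1 := hlow M le_rfl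
    have h2 : G * n ≤ G * (M * τ) := by linarith
    exact le_of_mul_le_mul_left h2 hG0
  have hidx : ∀ i < M, ∃ b, b < M ∧ M - i - 1 = b ∧ M - (i + 1) = b ∧ M - i = b + 1 :=
    fun i hi => ⟨M - i - 1, by omega, rfl, by omega, by omega⟩
  constructor
  · exact fun i _ => (hreg _ (Nat.sub_le _ _)).1
  · intro i hi
    obtain ⟨b, hb, e1, -, -⟩ := hidx i hi
    obtain ⟨h2, -, h3⟩ := hreg b hb.le
    simp only [e1]
    exact hk _ h2 (hlt b hb) h3
  · intro i hi
    obtain ⟨b, hb, e1, e2, -⟩ := hidx i hi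
    obtain ⟨h2, -, h3⟩ := hreg b hb.le
    simp only [e1, e2]
    exact hk1 _ h2 (hlt b hb) h3
  · intro i hi
    obtain ⟨b, hb, e1, e2, -⟩ := hidx i hi
    obtain ⟨h2, -, h3⟩ := hreg b hb.le
    simp only [e1, e2]
    exact hφ _ h2 (hlt b hb) h3
  · intro i hi
    obtain ⟨b, hb, -, e2, e3⟩ := hidx i hi
    obtain ⟨h2, -, h3⟩ := hreg b hb.le
    simp only [e2, e3, hXs, Nat.add_sub_cancel]
    exact (hFκ _ h2 (hlt b hb) h3).1
  · intro i hi
    obtain ⟨b, hb, -, e2, e3⟩ := hidx i hi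
    obtain ⟨h2, -, h3⟩ := hreg b hb.le
    simp only [e2, e3, hXs, Nat.add_sub_cancel]
    exact (hFκ _ h2 (hlt b hb) h3).2
  · intro i hi
    obtain ⟨b, hb, -, e2, e3⟩ := hidx i hi
    obtain ⟨h2, -, h3⟩ := hreg b hb.le
    simp only [e2, e3, hXs, Nat.add_sub_cancel]
    exact hFθ _ h2 (hlt b hb) h3
  · intro i hi
    obtain ⟨b, -, -, e2, e3⟩ := hidx i hi
    simp only [e2, e3, hΛs, hr, Nat.add_sub_cancel]
    ring
  · obtain ⟨-, h1, -⟩ := hreg M le_rfl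
    simp only [Nat.sub_zero]
    rw [abs_of_nonneg h1]
    linarith
  · simp
  · intro i _ j h1 h2
    obtain ⟨h3, -, h4⟩ := hreg (M - i) (Nat.sub_le _ _)
    have h5 := hVlarge _ h3 h4 j h1 h2
    have h6 := hgrow (M - i) (Nat.sub_le _ _)
    obtain ⟨h7, h8, -⟩ := hreg M le_rfl
    have h9 := mul_le_mul_of_nonneg_left (hVend _ h7 h8 hMd) (Real.exp_pos (Λ M - Λ (M - i))).le
    -- The bounds on `V` give `9/10 ≤ (11/10) e ^ ℓ + 1/10`, that is `e ^ ℓ ≥ 8/11`, which is more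
    -- than `e⁻¹`.
    by_contra! hneg
    have h10 : Real.exp (Λ M - Λ (M - i)) ≤ Real.exp (-1) := Real.exp_le_exp.2 hneg.le
    have h11 := Real.exp_neg_one_lt_d9
    linarith

end GainSystem




/-! ### Limits of step functions -/

theorem abs_sub_le_of_step {u : ℕ → ℝ} {M : ℕ} {τ L : ℝ} (hu : ∀ i < M, |u (i + 1) - u i| ≤ τ * L)
    {i j : ℕ} (hij : i ≤ j) (hj : j ≤ M) : |u j - u i| ≤ L * (j * τ - i * τ) := by
  induction j, hij using Nat.le_induction with
  | base => simp
  | succ j hij ih =>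
    have h1 := ih (by omega)
    have h2 := hu j (by omega)
    have h3 := abs_sub_le (u (j + 1)) (u j) (u i)
    push_cast
    linarith

theorem sub_le_of_step {u c : ℕ → ℝ} {M : ℕ} {τ C : ℝ} (hτ : 0 ≤ τ)
    (hu : ∀ i < M, u (i + 1) - u i ≤ τ * c i) {i j : ℕ} (hij : i ≤ j) (hj : j ≤ M)
    (hc : ∀ l, i ≤ l → l < j → c l ≤ C) : u j - u i ≤ (j * τ - i * τ) * C := by
  induction j, hij using Nat.le_induction with
  | base => simp
  | succ j hij ih =>
    have h1 := ih (by omega) fun l h1 h2 => hc l h1 (by omega)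
    have h2 := hu j (by omega)
    have h3 := mul_le_mul_of_nonneg_left (hc j hij (by omega)) hτ
    push_cast
    linarith

theorem tendsto_floor_div_mul {ι : Type*} {l : Filter ι} {τ : ι → ℝ} (hτ0 : ∀ n, 0 < τ n)
    (hτ : Tendsto τ l (𝓝 0)) {t : ℝ} (ht : 0 ≤ t) :
    Tendsto (fun n => (⌊t / τ n⌋₊ : ℝ) * τ n) l (𝓝 t) := by
  have h1 : Tendsto (fun n => t - τ n) l (𝓝 t) := by simpa using hτ.const_sub t
  refine tendsto_of_tendsto_of_tendsto_of_le_of_le h1 tendsto_const_nhds (fun n => ?_) fun n => ?_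
  · have := (div_lt_iff₀ (hτ0 n)).1 (Nat.lt_floor_add_one (t / τ n))
    simp only
    linarith
  · exact (le_div_iff₀ (hτ0 n)).1 (Nat.floor_le (div_nonneg ht (hτ0 n).le))

section

variable {l : Filter ℕ} {τ : ℕ → ℝ} {M : ℕ → ℕ}

theorem eventually_floor_lt (hτ0 : ∀ n, 0 < τ n) (hM : ∀ t, ∀ᶠ n in l, t < M n * τ n) {t : ℝ}
    (ht : 0 ≤ t) : ∀ᶠ n in l, ⌊t / τ n⌋₊ < M n := by
  filter_upwards [hM t] with n hn
  rw [Nat.floor_lt (div_nonneg ht (hτ0 n).le), div_lt_iff₀ (hτ0 n)]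
  exact hn

/-- One-sided rate bounds pass to the limit of step functions. -/
theorem sub_le_of_tendsto_step [l.NeBot] (hτ0 : ∀ n, 0 < τ n) (hτ : Tendsto τ l (𝓝 0))
    (hM : ∀ t, ∀ᶠ n in l, t < M n * τ n) {u c : ℕ → ℕ → ℝ} {v : ℝ → ℝ}
    (hv : ∀ t, 0 ≤ t → Tendsto (fun n => u n ⌊t / τ n⌋₊) l (𝓝 (v t)))
    (hu : ∀ n, ∀ i < M n, u n (i + 1) - u n i ≤ τ n * c n i) {s d C : ℝ}
    (hc : ∀ᶠ n in l, ∀ i < M n, |i * τ n - s| < d → c n i ≤ C) {t₁ t₂ : ℝ} (h0 : 0 ≤ t₁)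
    (h12 : t₁ ≤ t₂) (h1 : |t₁ - s| < d) (h2 : |t₂ - s| < d) : v t₂ - v t₁ ≤ (t₂ - t₁) * C := by
  have h02 := h0.trans h12
  refine le_of_tendsto_of_tendsto ((hv t₂ h02).sub (hv t₁ h0))
    (((tendsto_floor_div_mul hτ0 hτ h02).sub (tendsto_floor_div_mul hτ0 hτ h0)).mul_const C) ?_
  -- Rounding down lags by less than `τ n`, so the grid times involved lie in `(t₁ - τ n, t₂]`,
  -- eventually inside the window around `s`.
  have h3 : ∀ᶠ n in l, s - d < t₁ - τ n := by
    have h4 : Tendsto (fun n => t₁ - τ n) l (𝓝 t₁) := by simpa using hτ.const_sub t₁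
    exact h4.eventually_const_lt (by linarith [(abs_lt.1 h1).1])
  filter_upwards [hc, h3, eventually_floor_lt hτ0 hM h02] with n hn hn3 hnM
  refine sub_le_of_step (hτ0 n).le (hu n)
    (Nat.floor_le_floor (div_le_div_of_nonneg_right h12 (hτ0 n).le)) hnM.le fun i hi1 hi2 => ?_
  refine hn i (hi2.trans hnM) (abs_lt.2 ⟨?_, ?_⟩)
  · have h5 := (div_lt_iff₀ (hτ0 n)).1 (Nat.lt_floor_add_one (t₁ / τ n))
    have h6 : (⌊t₁ / τ n⌋₊ : ℝ) * τ n ≤ i * τ n :=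
      mul_le_mul_of_nonneg_right (by exact_mod_cast hi1) (hτ0 n).le
    linarith
  · have h5 := (le_div_iff₀ (hτ0 n)).1 (Nat.floor_le (div_nonneg h02 (hτ0 n).le))
    have h6 : (i : ℝ) * τ n ≤ ⌊t₂ / τ n⌋₊ * τ n :=
      mul_le_mul_of_nonneg_right (by exact_mod_cast hi2.le) (hτ0 n).le
    linarith [(abs_lt.1 h2).2]

/-- Step functions with uniformly bounded rates converge pointwise along an ultrafilter. -/
theorem exists_tendsto_step {U : Ultrafilter ℕ} (hτ0 : ∀ n, 0 < τ n)
    (hM : ∀ t, ∀ᶠ n in U, t < M n * τ n) {u : ℕ → ℕ → ℝ} {L B : ℝ} (hL : 0 ≤ L)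
    (hu : ∀ n, ∀ i < M n, |u n (i + 1) - u n i| ≤ τ n * L) (hB : ∀ n, |u n 0| ≤ B) :
    ∃ v : ℝ → ℝ, ∀ t, 0 ≤ t → Tendsto (fun n => u n ⌊t / τ n⌋₊) U (𝓝 (v t)) := by
  have h : ∀ t, ∃ x, 0 ≤ t → Tendsto (fun n => u n ⌊t / τ n⌋₊) U (𝓝 x) := by
    intro t
    by_cases ht : 0 ≤ t
    · obtain ⟨x, hx⟩ := U.exists_tendsto_of_abs_le (f := fun n => u n ⌊t / τ n⌋₊)
        (C := B + L * t) (by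
          filter_upwards [eventually_floor_lt hτ0 hM ht] with n hn
          have h1 := abs_sub_le_of_step (hu n) (Nat.zero_le _) hn.le
          have h2 := (le_div_iff₀ (hτ0 n)).1 (Nat.floor_le (div_nonneg ht (hτ0 n).le))
          have h3 := mul_le_mul_of_nonneg_left h2 hL
          have h4 := abs_add_le (u n ⌊t / τ n⌋₊ - u n 0) (u n 0)
          rw [sub_add_cancel] at h4
          simp only [Nat.cast_zero, zero_mul, sub_zero] at h1
          linarith [hB n])
      exact ⟨x, fun _ => hx⟩
    · exact ⟨0, fun h => absurd h ht⟩
  choose v hv using h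
  exact ⟨v, hv⟩

/-- Points close to a convergent sequence of step functions are close to the limit. -/
theorem eventually_abs_sub_lt_of_tendsto_step (hτ0 : ∀ n, 0 < τ n) (hτ : Tendsto τ l (𝓝 0))
    (hM : ∀ t, ∀ᶠ n in l, t < M n * τ n) {u w : ℕ → ℕ → ℝ} {v : ℝ → ℝ} {L : ℝ} (hL : 0 ≤ L)
    (hu : ∀ n, ∀ i < M n, |u n (i + 1) - u n i| ≤ τ n * L) {ε : ℕ → ℝ} (hε : Tendsto ε l (𝓝 0))
    (hw : ∀ n, ∀ i < M n, |w n i - u n (i + 1)| ≤ ε n)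
    (hv : ∀ t, 0 ≤ t → Tendsto (fun n => u n ⌊t / τ n⌋₊) l (𝓝 (v t))) {s r : ℝ} (hs : 0 ≤ s)
    (hr : 0 < r) :
    ∃ d > 0, ∀ᶠ n in l, ∀ i < M n, |i * τ n - s| < d → |w n i - v s| < r := by
  -- Budget: `r / 4` for the distance from `s`, and `r / 8` each for one step, for rounding, for `ε
  -- n` and for the convergence at `s`.
  refine ⟨r / (4 * (L + 1)), by positivity, ?_⟩
  have hτ' : Tendsto (fun n => L * τ n) l (𝓝 0) := by simpa using hτ.const_mul L
  have hfl : Tendsto (fun n => L * |s - ⌊s / τ n⌋₊ * τ n|) l (𝓝 0) := by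
    simpa using (((tendsto_floor_div_mul hτ0 hτ hs).const_sub s).abs).const_mul L
  have h8 : 0 < r / 8 := by positivity
  filter_upwards [hτ'.eventually_lt_const h8, hfl.eventually_lt_const h8, hε.eventually_lt_const h8,
    (hv s hs).eventually (Metric.ball_mem_nhds _ h8), eventually_floor_lt hτ0 hM hs]
    with n h1 h2 h3 h4 h5 i hi hid
  rw [lt_div_iff₀ (by positivity)] at hid
  have h6 : |u n (i + 1) - u n ⌊s / τ n⌋₊| ≤ L * |(i + 1 : ℕ) * τ n - ⌊s / τ n⌋₊ * τ n| := by
    rcases le_total ⌊s / τ n⌋₊ (i + 1) with h | h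
    · exact (abs_sub_le_of_step (hu n) h hi).trans
        (mul_le_mul_of_nonneg_left (le_abs_self _) hL)
    · rw [abs_sub_comm, abs_sub_comm (((i + 1 : ℕ) : ℝ) * τ n)]
      exact (abs_sub_le_of_step (hu n) h h5.le).trans
        (mul_le_mul_of_nonneg_left (le_abs_self _) hL)
  have h7 : |((i + 1 : ℕ) : ℝ) * τ n - ⌊s / τ n⌋₊ * τ n| ≤
      τ n + |i * τ n - s| + |s - ⌊s / τ n⌋₊ * τ n| := by
    have e : ((i + 1 : ℕ) : ℝ) * τ n - ⌊s / τ n⌋₊ * τ n =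
        τ n + (i * τ n - s) + (s - ⌊s / τ n⌋₊ * τ n) := by push_cast; ring
    rw [e]
    refine (abs_add_le _ _).trans (add_le_add ((abs_add_le _ _).trans ?_) le_rfl)
    rw [abs_of_pos (hτ0 n)]
  have h9 := mul_le_mul_of_nonneg_left h7 hL
  have h10 : L * |i * τ n - s| ≤ r / 4 := by nlinarith [abs_nonneg (i * τ n - s)]
  rw [Real.dist_eq] at h4
  have h11 := hw n i hi
  have h12 := abs_sub_le (w n i) (u n (i + 1)) (v s)
  have h13 := abs_sub_le (u n (i + 1)) (u n ⌊s / τ n⌋₊) (v s)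
  linarith

end

/-! ### Passage to the limit in the discrete trajectories -/

namespace GainSystem

/-- The limit of discrete trajectories: a relaxed gain together with a solution in polar
coordinates that does not tend to zero. -/
theorem exists_relaxed_trajectory {S : GainSystem} {L G H g₀ P α : ℝ} (hS : S.RateBounds L)
    (hg₀ : 0 < g₀) (hg : ∀ κ ∈ Icc (0 : ℝ) 1, ∀ θ : ℝ, g₀ ≤ S.g κ θ)
    (hG : ∀ k ∈ Icc (0 : ℝ) 1, ∀ θ, |S.g k θ| ≤ G) (hH : ∀ k ∈ Icc (0 : ℝ) 1, ∀ θ, |S.h k θ| ≤ H)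
    (hP : 0 < P) (hα : 0 < α)
    (hdisc : ∀ ε > 0, ∀ n : ℕ, ∃ (τ : ℝ) (M : ℕ) (κ θ ℓ k φ : ℕ → ℝ), 0 < τ ∧ τ ≤ ε ∧
      n ≤ M * τ ∧ S.IsDiscreteTrajectory P α ε τ M κ θ ℓ k φ) :
    ∃ κ θ ℓ : ℝ → ℝ, S.IsRelaxedGain L κ ∧
      (∀ t, 0 ≤ t → HasDerivWithinAt θ (S.g (κ t) (θ t)) (Ici 0) t) ∧
      (∀ t, 0 ≤ t → HasDerivWithinAt ℓ (S.h (κ t) (θ t)) (Ici 0) t) ∧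
      ∀ T, ∃ t, T ≤ t ∧ -1 ≤ ℓ t := by
  have hL := hS.nonneg
  have h01 : (0 : ℝ) ∈ Icc (0 : ℝ) 1 := by simp
  have hH0 : 0 ≤ H := (abs_nonneg _).trans (hH 0 h01 0)
  have hG0 : 0 ≤ G := (abs_nonneg _).trans (hG 0 h01 0)
  have hpos : ∀ n : ℕ, (0 : ℝ) < 1 / ((n : ℝ) + 1) := fun n => by positivity
  choose τ M κ θ ℓ k φ hτ0 hτε hMn hD using fun n : ℕ => hdisc _ (hpos n) n
  let U : Ultrafilter ℕ := hyperfilter ℕ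
  have hU : (U : Filter ℕ) ≤ atTop := Nat.hyperfilter_le_atTop
  have hε : Tendsto (fun n : ℕ => 1 / ((n : ℝ) + 1)) U (𝓝 0) :=
    tendsto_one_div_add_atTop_nhds_zero_nat.mono_left hU
  have hτ : Tendsto τ U (𝓝 0) := squeeze_zero (fun n => (hτ0 n).le) hτε hε
  have hM : ∀ t : ℝ, ∀ᶠ n in (U : Filter ℕ), t < M n * τ n := fun t =>
    hU ((tendsto_natCast_atTop_atTop.eventually_gt_atTop t).mono fun n hn => hn.trans_le (hMn n))
  have hκstep : ∀ n, ∀ i < M n, |κ n (i + 1) - κ n i| ≤ τ n * L := fun n i hi => by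
    have hk := (hD n).mem' i hi
    refine abs_le.2 ⟨le_trans ?_ ((hD n).lower i hi), ((hD n).upper i hi).trans ?_⟩
    · rw [← mul_neg]; exact mul_le_mul_of_nonneg_left (hS.le_min _ hk) (hτ0 n).le
    · exact mul_le_mul_of_nonneg_left (hS.max_le _ hk) (hτ0 n).le
  have hθstep : ∀ n, ∀ i < M n, |θ n (i + 1) - θ n i| ≤ τ n * G := fun n i hi => by
    rw [(hD n).angle i hi, abs_mul, abs_of_pos (hτ0 n)]
    exact mul_le_mul_of_nonneg_left (hG _ ((hD n).mem' i hi) _) (hτ0 n).le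
  have hℓstep : ∀ n, ∀ i < M n, |ℓ n (i + 1) - ℓ n i| ≤ τ n * H := fun n i hi => by
    rw [(hD n).log i hi, abs_mul, abs_of_pos (hτ0 n)]
    exact mul_le_mul_of_nonneg_left (hH _ ((hD n).mem' i hi) _) (hτ0 n).le
  obtain ⟨κ', hκ'⟩ := exists_tendsto_step hτ0 hM hL hκstep (B := 1) fun n => by
    have := (hD n).mem 0 (Nat.zero_le _)
    exact abs_le.2 ⟨by linarith [this.1], this.2⟩
  obtain ⟨θ', hθ'⟩ := exists_tendsto_step hτ0 hM hG0 hθstep fun n => (hD n).angle_zero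
  obtain ⟨ℓ', hℓ'⟩ := exists_tendsto_step hτ0 hM hH0 hℓstep (B := 0) fun n => by
    rw [(hD n).log_zero, abs_zero]
  -- continuous functions of the state are close to their values at the limit
  have hnear : ∀ F : ℝ × ℝ → ℝ, Continuous F → ∀ s, 0 ≤ s → ∀ η > 0, ∃ d > 0,
      ∀ᶠ n in (U : Filter ℕ), ∀ i < M n, |i * τ n - s| < d →
        |F (k n i, φ n i) - F (κ' s, θ' s)| < η := by
    intro F hF s hs η hη
    obtain ⟨r, hr, hr'⟩ := Metric.continuousAt_iff.1 (hF.continuousAt (x := (κ' s, θ' s))) η hη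
    obtain ⟨d₁, hd₁, h₁⟩ := eventually_abs_sub_lt_of_tendsto_step hτ0 hτ hM hL hκstep hε
      (fun n i hi => (hD n).close_gain i hi) hκ' hs hr
    obtain ⟨d₂, hd₂, h₂⟩ := eventually_abs_sub_lt_of_tendsto_step hτ0 hτ hM hG0 hθstep hε
      (fun n i hi => (hD n).close_angle i hi) hθ' hs hr
    refine ⟨min d₁ d₂, lt_min hd₁ hd₂, ?_⟩
    filter_upwards [h₁, h₂] with n hn₁ hn₂ i hi hid
    exact hr' (x := (k n i, φ n i)) (max_lt (hn₁ i hi (hid.trans_le (min_le_left _ _)))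
      (hn₂ i hi (hid.trans_le (min_le_right _ _))))
  -- equations for the derivative pass to the limit
  have hderiv : ∀ (u : ℕ → ℕ → ℝ) (v : ℝ → ℝ) (F : ℝ × ℝ → ℝ), Continuous F →
      (∀ t, 0 ≤ t → Tendsto (fun n => u n ⌊t / τ n⌋₊) U (𝓝 (v t))) →
      (∀ n, ∀ i < M n, u n (i + 1) - u n i = τ n * F (k n i, φ n i)) →
      ∀ t, 0 ≤ t → HasDerivWithinAt v (F (κ' t, θ' t)) (Ici 0) t := by
    intro u v F hF hv hu t ht
    rw [hasDerivWithinAt_iff_isLittleO, Asymptotics.isLittleO_iff]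
    intro η hη
    obtain ⟨d, hd, hn⟩ := hnear F hF t ht η hη
    -- Near `t` the discrete rates are within `η` of the limit rate; the one-sided bound applied to
    -- `v` and to `-v` gives the derivative from both sides.
    have hup : ∀ t₁ t₂, 0 ≤ t₁ → t₁ ≤ t₂ → |t₁ - t| < d → |t₂ - t| < d →
        v t₂ - v t₁ ≤ (t₂ - t₁) * (F (κ' t, θ' t) + η) := fun t₁ t₂ h0 h12 h1 h2 =>
      sub_le_of_tendsto_step hτ0 hτ hM hv (fun n i hi => (hu n i hi).le)
        (hn.mono fun n hn i hi hid => by linarith [(abs_lt.1 (hn i hi hid)).2]) h0 h12 h1 h2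
    have hlow : ∀ t₁ t₂, 0 ≤ t₁ → t₁ ≤ t₂ → |t₁ - t| < d → |t₂ - t| < d →
        -v t₂ - -v t₁ ≤ (t₂ - t₁) * (-F (κ' t, θ' t) + η) := fun t₁ t₂ h0 h12 h1 h2 =>
      sub_le_of_tendsto_step hτ0 hτ hM (u := fun n i => -u n i) (c := fun n i => -F (k n i, φ n i))
        (fun t ht => (hv t ht).neg) (fun n i hi => by linarith [hu n i hi])
        (hn.mono fun n hn i hi hid => by linarith [(abs_lt.1 (hn i hi hid)).1]) h0 h12 h1 h2
    have h0 : |t - t| < d := by simpa using hd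
    filter_upwards [mem_nhdsWithin_of_mem_nhds (Metric.ball_mem_nhds t hd), self_mem_nhdsWithin]
      with x hx hx0
    have hx' : |x - t| < d := hx
    rw [Real.norm_eq_abs, Real.norm_eq_abs, smul_eq_mul]
    rcases le_total t x with h | h
    · have h1 := hup t x ht h h0 hx'
      have h2 := hlow t x ht h h0 hx'
      rw [abs_of_nonneg (sub_nonneg.2 h)]
      exact abs_le.2 ⟨by linarith, by linarith⟩
    · have h1 := hup x t hx0 h hx' h0
      have h2 := hlow x t hx0 h hx' h0
      rw [abs_of_nonpos (sub_nonpos.2 h)]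
      exact abs_le.2 ⟨by linarith, by linarith⟩
  have hκmem : ∀ t, 0 ≤ t → κ' t ∈ Icc (0 : ℝ) 1 := fun t ht =>
    isClosed_Icc.mem_of_tendsto (hκ' t ht) ((eventually_floor_lt hτ0 hM ht).mono fun n hn =>
      (hD n).mem _ hn.le)
  have hκneg : ∀ t, 0 ≤ t → Tendsto (fun n => -κ n ⌊t / τ n⌋₊) U (𝓝 (-κ' t)) := fun t ht =>
    (hκ' t ht).neg
  have hright : ∀ u d : ℝ, 0 ≤ u → 0 < d → ∀ᶠ v in 𝓝[>] u, u ≤ v ∧ |v - u| < d := by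
    intro u d _ hd
    filter_upwards [mem_nhdsWithin_of_mem_nhds (Metric.ball_mem_nhds u hd), self_mem_nhdsWithin]
      with v hv hv'
    exact ⟨le_of_lt hv', hv⟩
  have hθd := hderiv θ θ' (fun p => S.g p.1 p.2) S.continuous_g hθ' fun n => (hD n).angle
  have hℓd := hderiv ℓ ℓ' (fun p => S.h p.1 p.2) S.continuous_h hℓ' fun n => (hD n).log
  refine ⟨κ', θ', ℓ', ⟨hκmem, ?_, ?_, ?_⟩, hθd, hℓd, ?_⟩
  · have key : ∀ s t, 0 ≤ s → s ≤ t → |κ' t - κ' s| ≤ L * (t - s) := by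
      intro s t hs hst
      have h1 : |s - s| < t - s + 1 := by rw [sub_self, abs_zero]; linarith
      have h2 : |t - s| < t - s + 1 := by rw [abs_of_nonneg (sub_nonneg.2 hst)]; linarith
      have h3 := sub_le_of_tendsto_step hτ0 hτ hM hκ' (c := fun _ _ => L)
        (fun n i hi => (le_abs_self _).trans (hκstep n i hi))
        (Eventually.of_forall fun _ _ _ _ => le_rfl) hs hst h1 h2
      have h4 := sub_le_of_tendsto_step hτ0 hτ hM (u := fun n i => -κ n i) (c := fun _ _ => L)
        hκneg (fun n i hi => by linarith [neg_le_abs (κ n (i + 1) - κ n i), hκstep n i hi])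
        (Eventually.of_forall fun _ _ _ _ => le_rfl) hs hst h1 h2
      exact abs_le.2 ⟨by linarith, by linarith⟩
    intro s t hs ht
    rcases le_total s t with h | h
    · rw [abs_of_nonneg (sub_nonneg.2 h)]; exact key s t hs h
    · rw [abs_sub_comm, abs_of_nonpos (sub_nonpos.2 h), neg_sub]; exact key t s ht h
  · intro u hu η hη
    obtain ⟨d, hd, hn⟩ := hnear (fun p => S.δmax (clamp p.1))
      (hS.continuous_max.comp continuous_fst) u hu η hη
    filter_upwards [hright u d hu hd] with v hv
    refine sub_le_of_tendsto_step hτ0 hτ hM hκ' (fun n i hi => (hD n).upper i hi)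
      (hn.mono fun n hn i hi hid => ?_) hu hv.1 (by simpa using hd) hv.2
    have := (abs_lt.1 (hn i hi hid)).2
    simp only [clamp_of_mem ((hD n).mem' i hi), clamp_of_mem (hκmem u hu)] at this
    linarith
  · intro u hu η hη
    obtain ⟨d, hd, hn⟩ := hnear (fun p => S.δmin (clamp p.1))
      (hS.continuous_min.comp continuous_fst) u hu η hη
    filter_upwards [hright u d hu hd] with v hv
    have h1 := sub_le_of_tendsto_step hτ0 hτ hM (u := fun n i => -κ n i)
      (c := fun n i => -S.δmin (k n i)) (C := -S.δmin (κ' u) + η) hκneg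
      (fun n i hi => by linarith [(hD n).lower i hi])
      (hn.mono fun n hn i hi hid => by
        have := (abs_lt.1 (hn i hi hid)).1
        simp only [clamp_of_mem ((hD n).mem' i hi), clamp_of_mem (hκmem u hu)] at this
        linarith) hu hv.1 (by simpa using hd) hv.2
    linarith
  · intro T
    obtain ⟨T₀, hT₀⟩ : ∃ T₀, T₀ = max T 0 := ⟨_, rfl⟩
    have hT₀0 : 0 ≤ T₀ := hT₀ ▸ le_max_right _ _
    have hgrow : ∀ t, 0 ≤ t → g₀ * t ≤ θ' t - θ' 0 := by
      intro t ht
      have h1 := sub_le_of_tendsto_step hτ0 hτ hM (u := fun n i => -θ n i)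
        (v := fun t => -θ' t) (c := fun _ _ => -g₀) (s := 0) (d := t + 1)
        (fun t ht => (hθ' t ht).neg)
        (fun n i hi => by
          have h2 := (hD n).angle i hi
          have h3 := mul_le_mul_of_nonneg_left (hg _ ((hD n).mem' i hi) (φ n i)) (hτ0 n).le
          linarith)
        (Eventually.of_forall fun _ _ _ _ => le_rfl) le_rfl ht
        (by rw [sub_self, abs_zero]; linarith) (by rw [sub_zero, abs_of_nonneg ht]; linarith)
      linarith
    obtain ⟨j, hj⟩ := exists_nat_ge (θ' T₀ / P)
    rw [div_le_iff₀ hP] at hj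
    -- The angle grows at least at rate `g₀`, so it passes `j P + α / 2` after `T₀`. This angle is
    -- interior to the window `[j P, j P + α]`, hence the discrete angles are eventually in it too
    -- and `-1 ≤ ℓ` passes to the limit.
    obtain ⟨t₁, ht₁⟩ : ∃ t₁, t₁ = max T₀ ((j * P + α / 2 - θ' 0) / g₀) := ⟨_, rfl⟩
    have h1 : T₀ ≤ t₁ := ht₁ ▸ le_max_left _ _
    have h2 : j * P + α / 2 - θ' 0 ≤ t₁ * g₀ := (div_le_iff₀ hg₀).1 (ht₁ ▸ le_max_right _ _)
    have h3 := hgrow t₁ (hT₀0.trans h1)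
    obtain ⟨t, ht, htj⟩ := intermediate_value_Icc h1
      (fun x hx => ((hθd x (hT₀0.trans hx.1)).continuousWithinAt.mono
        fun y hy => hT₀0.trans hy.1) : ContinuousOn θ' (Icc T₀ t₁))
      (show j * P + α / 2 ∈ Icc (θ' T₀) (θ' t₁) from ⟨by linarith, by linarith⟩)
    have ht0 : 0 ≤ t := hT₀0.trans ht.1
    refine ⟨t, (hT₀ ▸ le_max_left _ _ : T ≤ T₀).trans ht.1, ?_⟩
    refine ge_of_tendsto (hℓ' t ht0) ?_
    filter_upwards [eventually_floor_lt hτ0 hM ht0,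
      (hθ' t ht0).eventually_const_lt (show j * P < θ' t by linarith),
      (hθ' t ht0).eventually_lt_const (show θ' t < j * P + α by linarith)] with n hn h4 h5
    exact (hD n).large _ hn.le j h4.le h5.le

end GainSystem

end

/-! ### The instability theorem -/

theorem theorem2 (S : GainSystem)
    (hmin_cont : ContinuousOn S.δmin (Set.Icc 0 1))
    (hmax_cont : ContinuousOn S.δmax (Set.Icc 0 1))
    (hmin : ∀ κ ∈ Set.Icc (0 : ℝ) 1, S.δmin κ ≤ 0)
    (hmax : ∀ κ ∈ Set.Icc (0 : ℝ) 1, 0 ≤ S.δmax κ)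
    (hg : ∀ κ ∈ Set.Icc (0 : ℝ) 1, ∀ θ : ℝ, 0 < S.g κ θ)
    (ρ : ℝ → ℝ → ℝ) (hρ : S.IsViscositySolution ρ)
    (hN : ∃ N : ℕ, ∀ κ ∈ Set.Icc (0 : ℝ) 1, 1 < ρ κ (N * Real.pi)) :
    ¬ S.IsAbsolutelyStable := by
  obtain ⟨N, hN⟩ := hN
  have h01 : (0 : ℝ) ∈ Set.Icc (0 : ℝ) 1 := by simp
  -- `N = 0` is excluded by `ρ (κ, 0) = 1`.
  have hP : 0 < N * Real.pi := by
    rcases Nat.eq_zero_or_pos N with rfl | hpos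
    · have h1 := hN 0 h01
      rw [Nat.cast_zero, zero_mul, hρ.boundary 0 h01] at h1
      exact absurd h1 (lt_irrefl _)
    · exact mul_pos (by exact_mod_cast hpos) Real.pi_pos
  obtain ⟨L₁, hL₁⟩ := isCompact_Icc.exists_bound_of_continuousOn hmin_cont
  obtain ⟨L₂, hL₂⟩ := isCompact_Icc.exists_bound_of_continuousOn hmax_cont
  have hS : S.RateBounds (max L₁ L₂) := ⟨hmin_cont, hmax_cont, hmin, hmax,
    fun κ hκ => neg_le_of_abs_le ((hL₁ κ hκ).trans (le_max_left _ _)),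
    fun κ hκ => le_of_abs_le ((hL₂ κ hκ).trans (le_max_right _ _))⟩
  obtain ⟨g₀, hg₀, hg₀'⟩ := S.exists_pos_le_g hg
  obtain ⟨G, hG⟩ := GainSystem.exists_abs_le_of_periodic S.continuous_g S.g_periodic
  obtain ⟨H, hH⟩ := GainSystem.exists_abs_le_of_periodic S.continuous_h S.h_periodic
  have hshift : ∀ F : ℝ → ℝ → ℝ, (∀ k, Function.Periodic (F k) Real.pi) →
      ∀ k θ (j : ℕ), F k (θ + j * (N * Real.pi)) = F k θ := fun F hF k θ j => by
    have h1 := (hF k).nat_mul (j * N) θ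
    rwa [Nat.cast_mul, mul_assoc] at h1
  obtain ⟨α, hα0, hα1, hα⟩ :=
    GainSystem.exists_shift_gap hP hρ.continuousOn hρ.boundary hN
  obtain ⟨κ, θ, ℓ, hκ, hθ, hℓ, hlarge⟩ := GainSystem.exists_relaxed_trajectory hS hg₀ hg₀' hG hH
    hP hα0 fun ε hε n => GainSystem.exists_discreteTrajectory hS hg₀ hg₀' hG hH
      (hshift S.g S.g_periodic) (hshift S.h S.h_periodic) hP hρ hα0 hα1 hα hε n
  exact hκ.not_isAbsolutelyStable hS hθ hℓ hlarge
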